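/- Let $D\subset\mathbb{R}^d$ be a bounded open set (the local patch, e.g. the interior of a coarse triangle or quadrilateral), let $\Gamma=[-1,1]^{K}$, and let $\kappa(x,\xi)$, $x\in D$, $\xi\in\Gamma$, be a scalar coefficient, measurable in $x$, with $0<\kappa_{\min}\le\kappa(x,\xi)\le\kappa_{\max}<\infty$ for every $\xi\in\Gamma$ and a.e. $x\in D$. Assume that $\kappa(x,\cdot)$ is infinitely differentiable on $\Gamma$ for a.e. $x \in D$ and that there are constants $c_k>0$, $k=1,\dots,K$, such that $$\left\|\frac{\partial_{\xi_k}^{n}\kappa(\cdot,\xi)}{\kappa(\cdot,\xi)}\right\|_{L^\infty(D)}\le c_k^{\,n}\,n!\qquad\text{for all }n\ge 0,\ \xi\in\Gamma,\ k=1,\dots,K.$$ Let $p^{1},\dots,p^{L}\in H^1(D)$ and, for $\xi\in\Gamma$, let $\phi^{l}(\cdot,\xi)\in H^1(D)$ be the weak solution of $$-\nabla\cdot(\kappa(x,\xi)\nabla\phi^{l}(x,\xi))=0\ \text{ in }D,\qquad \phi^{l}(\cdot,\xi)=p^{l}\ \text{ on }\partial D$$ (that is, $\phi^l(\cdot,\xi)-p^l\in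 H^1_0(D)$). Let $$S_{ll'}(\xi)=\int_{D}\kappa(x,\xi)\,\nabla\phi^{l}(x,\xi)\cdot\nabla\phi^{l'}(x,\xi)\,\mathrm{d}x$$ be the local upscaled stiffness entries. For $\tau>0$ put $\Sigma([-1,1];\tau)=\{z\in\mathbb{C}:\operatorname{dist}(z,[-1,1])\le\tau\}$, and call $\tau$ admissible in direction $k$ (for given $l,l'$) if $S_{ll'}$, viewed as a function $[-1,1]\to C([-1,1]^{K-1})$ of the variable $\xi_k$, has an analytic extension to (an open neighbourhood of) $\Sigma([-1,1];\tau)$; equivalently, if $\tau$ is strictly smaller than the distance between $[-1,1]$ and the nearest singularity. Then for all $l,l'\in\{1,\dots,L\}$ the function $S_{ll'}$ is continuous on $\Gamma$; every $0<\tau<1/(2c_k)$ is admissible in direction $k$; and for all $\tau_1,\dots,\tau_K>0$ such that each $\tau_k$ is admissible in direction $k$, the numbers $$r_k=\log\left[\tau_k\left(1+\sqrt{1+1/\tau_k^{2}}\right)\right]$$ are positive and there is a constant $C_s>0$ such that for every $\nu=(\nu_1,\dots,\nu_K)\in\mathbb{N}_0^{K}$ $$\|S_{ll'}-\hat S_{ll'}\|_{C(\Gamma)}\le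 C_s\prod_{k=1}^{K}\left(\frac{2}{\pi}\log(\nu_k+1)+1\right)\sum_{k=1}^{K}\exp(-r_k\nu_k),$$ where $\hat S_{ll'}$ is the tensor-product Lagrange interpolant of $S_{ll'}$ at the Chebyshev nodes $\cos\frac{(2j+1)\pi}{2(\nu_k+1)}$, $j=0,\dots,\nu_k$, in the direction $\xi_k$, $k=1,\dots,K$. The constants $r_k$ and $C_s$ do not depend on $\nu$. -/

import Mathlib

open MeasureTheory Set TopologicalSpace
open scoped ContDiff Distributions RealInnerProductSpace

noncomputable section

namespace StoMsFEM

/-- The physical space `ℝ^d` with its Euclidean norm. -/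
abbrev Space (d : ℕ) := EuclideanSpace ℝ (Fin d)

/-- The parameter domain `Γ = [-1,1]^K`. -/
def paramCube (K : ℕ) : Set (Fin K → ℝ) := {ξ | ∀ k, ξ k ∈ Icc (-1 : ℝ) 1}

/-! ### Sobolev space and the cell problem -/

/-- `g` is the weak (distributional) gradient of `u` on the open set `D`. -/
def HasWeakGradient {d : ℕ} (D : Opens (Space d)) (u : Space d → ℝ)
    (g : Space d → Space d) : Prop :=
  ∀ ψ : 𝓓(D, ℝ), ∫ x in (D : Set (Space d)), u x • gradient ψ x
    = -∫ x in (D : Set (Space d)), ψ x • g x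

/-- An element of `H¹(D)`: a square-integrable function together with its square-integrable
weak gradient (which is determined by the function up to a null set). -/
structure SobolevH1 {d : ℕ} (D : Opens (Space d)) where
  /-- The underlying function. -/
  val : Space d → ℝ
  /-- Its weak gradient. -/
  grad : Space d → Space d
  val_memLp : MemLp val 2 (volume.restrict (D : Set (Space d)))
  grad_memLp : MemLp grad 2 (volume.restrict (D : Set (Space d)))
  hasWeakGradient : HasWeakGradient D val grad

/-- The difference `u - v` belongs to `H¹₀(D)`, the closure of `C_c^∞(D)` in the `H¹(D)` norm;
that is, `u = v` on `∂D` in the Sobolev sense. -/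
def EqOnBoundary {d : ℕ} {D : Opens (Space d)} (u v : SobolevH1 D) : Prop :=
  ∀ ε : ENNReal, 0 < ε → ∃ ψ : 𝓓(D, ℝ),
    eLpNorm (fun x => u.val x - v.val x - ψ x) 2 (volume.restrict (D : Set (Space d))) ≤ ε ∧
    eLpNorm (fun x => u.grad x - v.grad x - gradient ψ x) 2
      (volume.restrict (D : Set (Space d))) ≤ ε

/-- `φ ∈ H¹(D)` is the weak solution of `-∇·(a ∇φ) = 0` in `D`, `φ = p` on `∂D`. The boundary
datum is given by (any) function `p ∈ H¹(D)` with these boundary values. -/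
def IsCellSolution {d : ℕ} {D : Opens (Space d)} (a : Space d → ℝ) (p φ : SobolevH1 D) : Prop :=
  EqOnBoundary φ p ∧
    ∀ ψ : 𝓓(D, ℝ), ∫ x in (D : Set (Space d)), a x * ⟪φ.grad x, gradient ψ x⟫ = 0

/-- The local upscaled stiffness entry
`S_{ll'}(ξ) = ∫_D κ(x,ξ) ∇φ^l(x,ξ) · ∇φ^{l'}(x,ξ) dx`. -/
def stiffness {d K L : ℕ} {D : Opens (Space d)} (κ : Space d → (Fin K → ℝ) → ℝ)
    (φ : Fin L → (Fin K → ℝ) → SobolevH1 D) (l l' : Fin L) (ξ : Fin K → ℝ) : ℝ :=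
  ∫ x in (D : Set (Space d)), κ x ξ * ⟪(φ l ξ).grad x, (φ l' ξ).grad x⟫

/-! ### Growth of the derivatives of the coefficient -/

/-- The `n`-th partial derivative `∂^n f / ∂ξ_k^n` at `ξ ∈ [-1,1]^K` of a function on the cube
`[-1,1]^K` (one-sided on the faces). -/
def partialDeriv {K : ℕ} (k : Fin K) (n : ℕ) (f : (Fin K → ℝ) → ℝ) (ξ : Fin K → ℝ) : ℝ :=
  iteratedDerivWithin n (fun t => f (Function.update ξ k t)) (Icc (-1) 1) (ξ k)

/-! ### Analytic extension in one parameter -/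

/-- `Σ([-1,1]; τ) = {z ∈ ℂ : dist(z, [-1,1]) ≤ τ}`. -/
def complexNhd (τ : ℝ) : Set ℂ :=
  {z | Metric.infDist z ((fun t : ℝ => (t : ℂ)) '' Icc (-1) 1) ≤ τ}

/-- The parameter vector whose `k`-th entry is `t` and whose other entries are given by `η`. -/
def insertParam {K : ℕ} (k : Fin K) (t : ℝ) (η : {j : Fin K // j ≠ k} → Icc (-1 : ℝ) 1) :
    Fin K → ℝ :=
  fun j => if h : j = k then t else (η ⟨j, h⟩ : ℝ)

/-- `S`, as a function `[-1,1] → C([-1,1]^{K-1})` of the single variable `ξ_k`, has an analytic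
extension to (a neighbourhood of every point of) `Σ([-1,1]; τ)`. Equivalently, `τ` is strictly
smaller than the distance from `[-1,1]` to the nearest singularity. -/
def HasAnalyticExtension {K : ℕ} (S : (Fin K → ℝ) → ℝ) (k : Fin K) (τ : ℝ) : Prop :=
  ∃ F : ℂ → C({j : Fin K // j ≠ k} → Icc (-1 : ℝ) 1, ℂ),
    AnalyticOnNhd ℂ F (complexNhd τ) ∧
    ∀ t ∈ Icc (-1 : ℝ) 1, ∀ η, F (t : ℂ) η = ((S (insertParam k t η) : ℝ) : ℂ)

/-- `r = log[τ (1 + √(1 + 1/τ²))]`. -/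
def decayRate (τ : ℝ) : ℝ := Real.log (τ * (1 + Real.sqrt (1 + 1 / τ ^ 2)))

/-! ### Tensor-product Chebyshev interpolation -/

/-- The `n + 1` Chebyshev nodes in `[-1,1]`, i.e. the zeros of the Chebyshev polynomial
`T_{n+1}`. -/
def chebyshevNode (n : ℕ) (j : Fin (n + 1)) : ℝ :=
  Real.cos ((2 * (j : ℝ) + 1) * Real.pi / (2 * ((n : ℝ) + 1)))

/-- The tensor-product Lagrange interpolant of `f` at the Chebyshev nodes, with `ν k + 1` nodes in
the direction `k`. -/
def chebyshevInterpolant {K : ℕ} (ν : Fin K → ℕ) (f : (Fin K → ℝ) → ℝ) (ξ : Fin K → ℝ) : ℝ :=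
  ∑ j : (k : Fin K) → Fin (ν k + 1),
    f (fun k => chebyshevNode (ν k) (j k)) *
      ∏ k, (Lagrange.basis Finset.univ (chebyshevNode (ν k)) (j k)).eval (ξ k)

end StoMsFEM

end

/-! ### The Lebesgue constant of the Chebyshev nodes -/

namespace StoMsFEM

open Polynomial Polynomial.Chebyshev

/-! The proof has an analytic half and an approximation half, linked only by `HasAnalyticExtension`.

Analyticity. Only gradients matter, so everything takes place in `L²(D; ℝ^d)`, with `V` the closure
of the gradients of test functions; there the weighted form is coercive without any Poincaré
inequality. Fix a base point and move `ξ_k` by `s`. The Taylor coefficients `b n` of `κ` satisfy `|b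
n| ≤ c^n * b 0`, so the forms `B n` they define are bounded by `c^n` in the energy norm of `B 0`.
Inserting `∑ s^n g_n` into the weak equation gives a recursion for `g_n`; testing it with `g_n`
itself yields energy norms at most `(2c)^n` times that of the boundary datum
(`sqrt_energy_solutionCoeff_le`). This doubling is the origin of `1/(2c)`. By orthogonality the
second solution in the energy may be replaced by its boundary datum, so `S` has a power series with
coefficients `O((2c)^n)` (`exists_energy_expansion`), uniformly in the base point. The discs around
all points of `[-1,1]` are glued by the identity theorem (`exists_analyticOnNhd_of_series`). The
remaining parameters enter through values in a space of continuous functions: the coefficients are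
continuous because they are uniform limits of quotients built from `S` (`continuous_coeff`), and `S`
is Lipschitz in each coordinate.

Approximation. With `ρ = exp (decayRate τ)` one has `ρ - ρ⁻¹ = 2τ`, so the Bernstein ellipse of
parameter `ρ` lies in `Σ([-1,1]; τ)`. Shifting the contour for the Fourier coefficients of `f (cos
θ)` to `|w| = ρ` makes them decay like `ρ^(-n)` (`exists_polynomial_approx`). Interpolation loses
only the Lebesgue constant, which is logarithmic for Chebyshev nodes (`sum_abs_eval_basis_le`), and
switching on one direction at a time reduces the tensor product to one variable
(`abs_sub_chebyshevInterpolant_le`). -/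

/-- The angle of the `j`-th Chebyshev node. -/
noncomputable def chebyshevAngle (n j : ℕ) : ℝ :=
  (2 * (j : ℝ) + 1) * Real.pi / (2 * ((n : ℝ) + 1))

lemma chebyshevNode_eq_cos (n : ℕ) (j : Fin (n + 1)) :
    chebyshevNode n j = Real.cos (chebyshevAngle n j) := rfl

lemma chebyshevAngle_pos (n j : ℕ) : 0 < chebyshevAngle n j := by
  unfold chebyshevAngle; positivity

lemma chebyshevAngle_lt_pi {n j : ℕ} (hj : j < n + 1) : chebyshevAngle n j < Real.pi := by
  unfold chebyshevAngle
  rw [div_lt_iff₀ (by positivity)]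
  have h : (j : ℝ) ≤ n := by exact_mod_cast Nat.lt_succ_iff.mp hj
  nlinarith [Real.pi_pos]

lemma chebyshevNode_mem (n : ℕ) (j : Fin (n + 1)) : chebyshevNode n j ∈ Icc (-1 : ℝ) 1 :=
  Real.cos_mem_Icc _

lemma chebyshevNode_injective (n : ℕ) : Function.Injective (chebyshevNode n) := by
  intro i j h
  have h1 : chebyshevAngle n i = chebyshevAngle n j :=
    Real.injOn_cos ⟨(chebyshevAngle_pos n i).le, (chebyshevAngle_lt_pi i.2).le⟩
      ⟨(chebyshevAngle_pos n j).le, (chebyshevAngle_lt_pi j.2).le⟩ h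
  unfold chebyshevAngle at h1
  have hp := Real.pi_pos
  field_simp at h1
  have h2 : ((i : ℕ) : ℝ) = ((j : ℕ) : ℝ) := by linarith
  exact Fin.ext (by exact_mod_cast h2)

lemma cos_mul_chebyshevAngle (n j : ℕ) :
    Real.cos (((n : ℝ) + 1) * chebyshevAngle n j) = 0 := by
  rw [Real.cos_eq_zero_iff]
  refine ⟨j, ?_⟩
  unfold chebyshevAngle
  push_cast
  field_simp

lemma T_eq_C_mul_nodal (n : ℕ) :
    T ℝ (n + 1 : ℤ) =
      C (T ℝ (n + 1 : ℤ)).leadingCoeff * Lagrange.nodal Finset.univ (chebyshevNode n) := by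
  have hroot := roots_T_real (n + 1)
  have hinj : Set.InjOn (fun k : ℕ => Real.cos ((2 * k + 1) * Real.pi / (2 * (n + 1 : ℕ))))
      (Finset.range (n + 1)) :=
    (Finset.range (n + 1)).nodup_map_iff_injOn.mp (roots_T_real_nodup (n + 1))
  have hcard : Multiset.card (T ℝ ((n + 1 : ℕ) : ℤ)).roots = (T ℝ ((n + 1 : ℕ) : ℤ)).natDegree := by
    rw [hroot, natDegree_T, Finset.card_val, Finset.card_image_of_injOn hinj]
    rw [Finset.card_range, Int.natAbs_natCast]
  have h := C_leadingCoeff_mul_prod_multiset_X_sub_C hcard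
  rw [hroot] at h
  push_cast at h
  conv_lhs => rw [← h]
  congr 1
  rw [Lagrange.nodal]
  simp only [chebyshevNode]
  rw [Fin.prod_univ_eq_prod_range
    (fun j : ℕ => X - C (Real.cos ((2 * (j : ℝ) + 1) * Real.pi / (2 * ((n : ℝ) + 1))))) (n + 1)]
  simp only [Nat.cast_add, Nat.cast_one] at hinj
  exact Finset.prod_image (f := fun a => X - C a) hinj

/-- The classical `ℓ_j(x) = T(x) / (T'(x_j)(x - x_j))`, cleared of denominators so that it also
holds at the node, where both sides vanish. -/
lemma eval_basis_mul (n : ℕ) (j : Fin (n + 1)) (x : ℝ) :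
    (Lagrange.basis Finset.univ (chebyshevNode n) j).eval x *
      ((derivative (T ℝ (n + 1 : ℤ))).eval (chebyshevNode n j) * (x - chebyshevNode n j)) =
      (T ℝ (n + 1 : ℤ)).eval x := by
  have hT := T_eq_C_mul_nodal n
  set a := (T ℝ (n + 1 : ℤ)).leadingCoeff
  by_cases hx : x = chebyshevNode n j
  · rw [hx, hT]
    simp [Lagrange.eval_nodal_at_node]
  have hw := Lagrange.nodalWeight_ne_zero (s := Finset.univ) (v := chebyshevNode n) (i := j)
    (chebyshevNode_injective n).injOn (Finset.mem_univ _)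
  have hw' := Lagrange.nodalWeight_eq_eval_derivative_nodal (v := chebyshevNode n)
    (Finset.mem_univ j)
  rw [Lagrange.eval_basis_not_at_node (Finset.mem_univ j) hx, hT]
  have hx' : x - chebyshevNode n j ≠ 0 := sub_ne_zero.mpr hx
  simp only [derivative_C_mul, eval_mul, eval_C]
  rw [hw'] at hw ⊢
  have hd : eval (chebyshevNode n j) (derivative (Lagrange.nodal Finset.univ (chebyshevNode n))) ≠ 0 :=
    fun h => hw (by rw [h, inv_zero])
  field_simp

/-- `T' = (n+1) U_n` and `U_n(cos θ) sin θ = sin((n+1)θ)`, which is `±1` at a node because the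
cosine vanishes there. -/
lemma abs_eval_derivative_T_mul_sin (n : ℕ) (j : Fin (n + 1)) :
    |(derivative (T ℝ (n + 1 : ℤ))).eval (chebyshevNode n j)| * Real.sin (chebyshevAngle n j) =
      n + 1 := by
  have hs : 0 < Real.sin (chebyshevAngle n j) :=
    Real.sin_pos_of_pos_of_lt_pi (chebyshevAngle_pos n j) (chebyshevAngle_lt_pi j.2)
  have h1 := U_real_cos (chebyshevAngle n j) (n : ℤ)
  have h2 : |Real.sin (((n : ℝ) + 1) * chebyshevAngle n j)| = 1 := by
    have := Real.sin_sq_add_cos_sq (((n : ℝ) + 1) * chebyshevAngle n j)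
    rw [cos_mul_chebyshevAngle] at this
    rw [← sq_eq_sq₀ (abs_nonneg _) zero_le_one, sq_abs]
    linarith
  rw [T_derivative_eq_U, chebyshevNode_eq_cos]
  nth_rw 1 [← abs_of_pos hs]
  rw [← abs_mul, eval_mul, add_sub_cancel_right, mul_assoc, h1, abs_mul]
  push_cast
  rw [h2]
  have : eval (Real.cos (chebyshevAngle n j)) ((n : ℝ[X]) + 1) = (n : ℝ) + 1 := by simp
  rw [this, mul_one, abs_of_nonneg (by positivity)]

lemma abs_div_pi_le_abs_sin_half {x : ℝ} (hx : |x| ≤ Real.pi) :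
    |x| / Real.pi ≤ |Real.sin (x / 2)| := by
  have h : ∀ y : ℝ, 0 ≤ y → y ≤ Real.pi → y / Real.pi ≤ |Real.sin (y / 2)| := by
    intro y h0 h1
    have := Real.mul_le_sin (x := y / 2) (by linarith) (by linarith)
    refine le_trans (le_of_eq ?_) (this.trans (le_abs_self _))
    ring
  have h2 := h |x| (abs_nonneg _) hx
  rcases abs_choice x with h3 | h3
  · rwa [h3] at h2 ⊢
  · rw [h3] at h2 ⊢
    rwa [neg_div 2 x, Real.sin_neg, abs_neg] at h2

/-- Since `sin(a/2) + cos(a/2) ≥ 1`, the addition formula bounds `sin((a+b)/2)` below by `sin(b/2)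
cos(b/2)`, this product being at most each of its factors. -/
lemma sin_le_two_mul_sin_half_add {a b : ℝ} (ha : a ∈ Icc 0 Real.pi) (hb : b ∈ Icc 0 Real.pi) :
    Real.sin b ≤ 2 * Real.sin ((a + b) / 2) := by
  have hs : Real.sin b = 2 * Real.sin (b / 2) * Real.cos (b / 2) := by
    rw [← Real.sin_two_mul]; congr 1; ring
  have h1 : 0 ≤ Real.sin (b / 2) :=
    Real.sin_nonneg_of_nonneg_of_le_pi (by linarith [hb.1]) (by linarith [hb.2, hb.1])
  have h2 : 0 ≤ Real.cos (b / 2) :=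
    Real.cos_nonneg_of_neg_pi_div_two_le_of_le (by linarith [hb.1, Real.pi_pos]) (by linarith [hb.2])
  have h3 : 0 ≤ Real.sin (a / 2) :=
    Real.sin_nonneg_of_nonneg_of_le_pi (by linarith [ha.1]) (by linarith [ha.2, ha.1])
  have h4 : 0 ≤ Real.cos (a / 2) :=
    Real.cos_nonneg_of_neg_pi_div_two_le_of_le (by linarith [ha.1, Real.pi_pos]) (by linarith [ha.2])
  rw [add_div, Real.sin_add, hs]
  have e1 := Real.sin_sq_add_cos_sq (a / 2)
  have h5 : 1 ≤ Real.sin (a / 2) + Real.cos (a / 2) := by nlinarith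
  have l1 := Real.sin_le_one (b / 2)
  have l2 := Real.cos_le_one (b / 2)
  have m1 : Real.sin (b / 2) * Real.cos (b / 2) ≤ Real.sin (b / 2) := by nlinarith
  have m2 : Real.sin (b / 2) * Real.cos (b / 2) ≤ Real.cos (b / 2) := by nlinarith
  nlinarith [mul_nonneg h3 (sub_nonneg.mpr m2), mul_nonneg h4 (sub_nonneg.mpr m1),
    mul_nonneg h1 h2]

/-- In `cos θ - cos φ = -2 sin((θ+φ)/2) sin((θ-φ)/2)` the first sine absorbs the `sin φ` attached to
`T'(x_j)`, and Jordan's inequality turns the second into `|θ - φ| / π`. -/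
lemma abs_eval_basis_mul_le {n : ℕ} (j : Fin (n + 1)) {θ : ℝ} (hθ : θ ∈ Icc 0 Real.pi) :
    |(Lagrange.basis Finset.univ (chebyshevNode n) j).eval (Real.cos θ)| *
      (((n : ℝ) + 1) * |θ - chebyshevAngle n j|) ≤
      Real.pi * |Real.cos (((n : ℝ) + 1) * θ)| := by
  set φ := chebyshevAngle n j
  have hφ : φ ∈ Icc 0 Real.pi := ⟨(chebyshevAngle_pos n j).le, (chebyshevAngle_lt_pi j.2).le⟩
  have hs : 0 < Real.sin φ :=
    Real.sin_pos_of_pos_of_lt_pi (chebyshevAngle_pos n j) (chebyshevAngle_lt_pi j.2)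
  have h1 := congrArg abs (eval_basis_mul n j (Real.cos θ))
  rw [abs_mul, abs_mul, T_real_cos] at h1
  push_cast at h1
  have h2 := abs_eval_derivative_T_mul_sin n j
  set B := |(Lagrange.basis Finset.univ (chebyshevNode n) j).eval (Real.cos θ)|
  set T' := |(derivative (T ℝ (n + 1 : ℤ))).eval (chebyshevNode n j)|
  have h3 : |Real.cos θ - chebyshevNode n j| =
      2 * |Real.sin ((θ + φ) / 2)| * |Real.sin ((θ - φ) / 2)| := by
    rw [chebyshevNode_eq_cos, Real.cos_sub_cos, abs_mul, abs_mul]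
    norm_num [φ]
  have h4 : |θ - φ| / Real.pi ≤ |Real.sin ((θ - φ) / 2)| :=
    abs_div_pi_le_abs_sin_half (abs_sub_le_iff.mpr
      ⟨by linarith [hθ.2, hφ.1], by linarith [hθ.1, hφ.2]⟩)
  have h5 : Real.sin φ ≤ 2 * |Real.sin ((θ + φ) / 2)| :=
    (sin_le_two_mul_sin_half_add hθ hφ).trans (by gcongr; exact le_abs_self _)
  have h6 : Real.sin φ * (|θ - φ| / Real.pi) ≤ |Real.cos θ - chebyshevNode n j| := by
    rw [h3]; gcongr
  have hB : 0 ≤ B := abs_nonneg _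
  have hT' : 0 ≤ T' := abs_nonneg _
  have h7 : B * (T' * (Real.sin φ * (|θ - φ| / Real.pi))) ≤ |Real.cos (((n : ℝ) + 1) * θ)| := by
    rw [← h1]; gcongr
  rw [← mul_assoc T', h2] at h7
  have hp := Real.pi_pos
  calc B * (((n : ℝ) + 1) * |θ - φ|)
      = Real.pi * (B * ((n + 1) * (|θ - φ| / Real.pi))) := by field_simp
    _ ≤ _ := by gcongr

/-- Covers the node nearest to `θ`: `cos((n+1)θ)` vanishes at the node's angle and is Lipschitz with
constant `n+1`, which cancels the distance in the previous bound. -/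
lemma abs_eval_basis_le_pi {n : ℕ} (j : Fin (n + 1)) {θ : ℝ} (hθ : θ ∈ Icc 0 Real.pi) :
    |(Lagrange.basis Finset.univ (chebyshevNode n) j).eval (Real.cos θ)| ≤ Real.pi := by
  by_cases h : θ = chebyshevAngle n j
  · rw [h, ← chebyshevNode_eq_cos, Lagrange.eval_basis_self (chebyshevNode_injective n).injOn
      (Finset.mem_univ j), abs_one]
    linarith [Real.pi_gt_three]
  have h0 : 0 < |θ - chebyshevAngle n j| := abs_pos.mpr (sub_ne_zero.mpr h)
  have h1 := abs_eval_basis_mul_le j hθ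
  have h2 : |Real.cos (((n : ℝ) + 1) * θ)| ≤ ((n : ℝ) + 1) * |θ - chebyshevAngle n j| := by
    have := Real.abs_cos_sub_cos_le (((n : ℝ) + 1) * θ) (((n : ℝ) + 1) * chebyshevAngle n j)
    rwa [cos_mul_chebyshevAngle, sub_zero, ← mul_sub, abs_mul,
      abs_of_nonneg (by positivity : (0 : ℝ) ≤ (n : ℝ) + 1)] at this
  have h3 : 0 < ((n : ℝ) + 1) * |θ - chebyshevAngle n j| := by positivity
  have h4 : Real.pi * |Real.cos (((n : ℝ) + 1) * θ)| ≤
      Real.pi * (((n : ℝ) + 1) * |θ - chebyshevAngle n j|) := by gcongr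
  exact le_of_mul_le_mul_right (h1.trans h4) h3

lemma sum_inv_le_one_add_log {m N : ℕ} (hm : m ≤ N + 1) :
    ∑ i ∈ Finset.range m, 2 / ((i : ℝ) + 1) ≤ 2 * (1 + Real.log ((N : ℝ) + 1)) := by
  have h := harmonic_le_one_add_log (N + 1)
  rw [harmonic] at h
  push_cast at h
  calc ∑ i ∈ Finset.range m, 2 / ((i : ℝ) + 1)
      ≤ ∑ i ∈ Finset.range (N + 1), 2 / ((i : ℝ) + 1) :=
        Finset.sum_le_sum_of_subset_of_nonneg (Finset.range_subset_range.mpr hm)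
          (fun i _ _ => by positivity)
    _ = 2 * ∑ i ∈ Finset.range (N + 1), ((i : ℝ) + 1)⁻¹ := by
        rw [Finset.mul_sum]; rfl
    _ ≤ _ := by gcongr

/-- In the variable `x = (n+1)θ/π` the nodes sit at the half-integers `j + 1/2`. The index `⌊x⌋`
gets the uniform bound `π`; on either side the distances grow linearly, giving two harmonic sums. -/
lemma sum_le_of_mul_dist_le {N : ℕ} {a : ℕ → ℝ} {x : ℝ} (hx0 : 0 ≤ x) (hxN : x ≤ N + 1)
    (ha : ∀ j, 0 ≤ a j) (h1 : ∀ j < N + 1, a j ≤ Real.pi)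
    (h2 : ∀ j < N + 1, a j * |x - j - 1 / 2| ≤ 1) :
    ∑ j ∈ Finset.range (N + 1), a j ≤ Real.pi + 4 * (1 + Real.log ((N : ℝ) + 1)) := by
  set i := ⌊x⌋₊
  have hi0 : (i : ℝ) ≤ x := Nat.floor_le hx0
  have hi1 : x < i + 1 := Nat.lt_floor_add_one x
  have hiN : i ≤ N + 1 := by
    have : (i : ℝ) ≤ (N + 1 : ℕ) := by push_cast; linarith
    exact_mod_cast this
  -- The floor equals `N + 1` when `x` is the right endpoint, so the singleton has to be cut with
  -- the range.
  have hsub : Finset.range (N + 1) ⊆ (Finset.range i ∪ {i} ∩ Finset.range (N + 1)) ∪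
      Finset.Ico (i + 1) (N + 1) := by
    intro j hj
    simp only [Finset.mem_range, Finset.mem_union, Finset.mem_inter, Finset.mem_singleton,
      Finset.mem_Ico] at hj ⊢
    omega
  have hA : ∑ j ∈ Finset.range i, a j ≤ 2 * (1 + Real.log ((N : ℝ) + 1)) := by
    refine le_trans ?_ (sum_inv_le_one_add_log hiN)
    rw [← Finset.sum_range_reflect (fun j => 2 / ((j : ℝ) + 1))]
    refine Finset.sum_le_sum fun j hj => ?_
    have hj := Finset.mem_range.mp hj
    have hc : ((i - 1 - j : ℕ) : ℝ) + 1 = i - j := by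
      have : (i - 1 - j) + 1 + j = i := by omega
      have := congrArg (Nat.cast : ℕ → ℝ) this
      push_cast at this
      linarith
    have hji : (j : ℝ) + 1 ≤ i := by exact_mod_cast hj
    rw [hc, le_div_iff₀ (by linarith)]
    have h3 := h2 j (by omega)
    have h4 : ((i : ℝ) - j) / 2 ≤ |x - j - 1 / 2| := le_trans (by linarith) (le_abs_self _)
    nlinarith [mul_le_mul_of_nonneg_left h4 (ha j)]
  have hB : ∑ j ∈ Finset.Ico (i + 1) (N + 1), a j ≤ 2 * (1 + Real.log ((N : ℝ) + 1)) := by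
    refine le_trans ?_ (sum_inv_le_one_add_log (m := N + 1 - (i + 1)) (by omega))
    rw [Finset.sum_Ico_eq_sum_range]
    refine Finset.sum_le_sum fun j hj => ?_
    have hj := Finset.mem_range.mp hj
    rw [le_div_iff₀ (by positivity)]
    have h3 := h2 (i + 1 + j) (by omega)
    have h4 : ((j : ℝ) + 1) / 2 ≤ |x - (i + 1 + j : ℕ) - 1 / 2| := by
      rw [abs_sub_comm, abs_sub_comm]
      refine le_trans ?_ (neg_le_abs _)
      push_cast
      have : (0 : ℝ) ≤ j := by positivity
      linarith
    nlinarith [mul_le_mul_of_nonneg_left h4 (ha (i + 1 + j))]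
  have hC : ∑ j ∈ {i} ∩ Finset.range (N + 1), a j ≤ Real.pi := by
    by_cases h : i < N + 1
    · rw [Finset.inter_eq_left.mpr (by simpa using h), Finset.sum_singleton]
      exact h1 i h
    · rw [Finset.singleton_inter_of_notMem (by simpa using h), Finset.sum_empty]
      exact Real.pi_pos.le
  calc ∑ j ∈ Finset.range (N + 1), a j
      ≤ ∑ j ∈ (Finset.range i ∪ {i} ∩ Finset.range (N + 1)) ∪ Finset.Ico (i + 1) (N + 1), a j :=
        Finset.sum_le_sum_of_subset_of_nonneg hsub (fun j _ _ => ha j)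
    _ ≤ (∑ j ∈ Finset.range i, a j + ∑ j ∈ {i} ∩ Finset.range (N + 1), a j) +
        ∑ j ∈ Finset.Ico (i + 1) (N + 1), a j := by
        have hu : ∀ s t : Finset ℕ, ∑ j ∈ s ∪ t, a j ≤ ∑ j ∈ s, a j + ∑ j ∈ t, a j := by
          intro s t
          rw [← Finset.sum_union_inter]
          linarith [Finset.sum_nonneg (s := s ∩ t) fun j _ => ha j]
        exact (hu _ _).trans (add_le_add_left (hu _ _) _)
    _ ≤ _ := by linarith

/-- The factor `(2/π) log (n + 1) + 1` that governs the Lebesgue constant of `n + 1` nodes. -/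
noncomputable def lebesgueFactor (n : ℕ) : ℝ := 2 / Real.pi * Real.log ((n : ℝ) + 1) + 1

lemma one_le_lebesgueFactor (n : ℕ) : 1 ≤ lebesgueFactor n := by
  have : 0 ≤ Real.log ((n : ℝ) + 1) := Real.log_nonneg (by linarith [n.cast_nonneg (α := ℝ)])
  have hp := Real.pi_pos
  have : 0 ≤ 2 / Real.pi * Real.log ((n : ℝ) + 1) := by positivity
  unfold lebesgueFactor; linarith

/-- The Lebesgue constant of the Chebyshev nodes grows at most logarithmically. -/
theorem sum_abs_eval_basis_le (n : ℕ) {x : ℝ} (hx : x ∈ Icc (-1 : ℝ) 1) :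
    ∑ j, |(Lagrange.basis Finset.univ (chebyshevNode n) j).eval x| ≤ 8 * lebesgueFactor n := by
  obtain ⟨θ, hθ, rfl⟩ : ∃ θ ∈ Icc 0 Real.pi, Real.cos θ = x :=
    ⟨Real.arccos x, ⟨Real.arccos_nonneg x, Real.arccos_le_pi x⟩, Real.cos_arccos hx.1 hx.2⟩
  have hp := Real.pi_pos
  let a : ℕ → ℝ := fun j => if h : j < n + 1 then
    |(Lagrange.basis Finset.univ (chebyshevNode n) ⟨j, h⟩).eval (Real.cos θ)| else 0
  have hsum : ∑ j, |(Lagrange.basis Finset.univ (chebyshevNode n) j).eval (Real.cos θ)| =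
      ∑ j ∈ Finset.range (n + 1), a j := by
    rw [Finset.sum_range]
    refine Finset.sum_congr rfl fun j _ => ?_
    simp only [a, j.2, dite_true]
  have hpos : (0 : ℝ) < (n : ℝ) + 1 := by positivity
  have hmain : ∑ j ∈ Finset.range (n + 1), a j ≤
      Real.pi + 4 * (1 + Real.log ((n : ℝ) + 1)) := by
    refine sum_le_of_mul_dist_le (x := ((n : ℝ) + 1) * θ / Real.pi) ?_ ?_ ?_ ?_ ?_
    · have := hθ.1; positivity
    · rw [div_le_iff₀ hp]; gcongr; exact hθ.2
    · intro j; simp only [a]; split_ifs <;> positivity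
    · intro j hj
      simp only [a, hj, dite_true]
      exact abs_eval_basis_le_pi _ hθ
    · intro j hj
      simp only [a, hj, dite_true]
      have h1 := abs_eval_basis_mul_le ⟨j, hj⟩ hθ
      have h2 := Real.abs_cos_le_one (((n : ℝ) + 1) * θ)
      have h3 : ((n : ℝ) + 1) * |θ - chebyshevAngle n j| =
          Real.pi * |((n : ℝ) + 1) * θ / Real.pi - j - 1 / 2| := by
        rw [← abs_of_pos hpos, ← abs_of_pos hp, ← abs_mul, ← abs_mul, abs_of_pos hpos,
          abs_of_pos hp]
        congr 1
        unfold chebyshevAngle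
        field_simp
        ring
      rw [h3] at h1
      refine le_of_mul_le_mul_left ?_ hp
      calc _ = _ := by ring
        _ ≤ _ := h1
        _ ≤ _ := by gcongr
  have hlog : 0 ≤ Real.log ((n : ℝ) + 1) := Real.log_nonneg (by linarith [n.cast_nonneg (α := ℝ)])
  rw [hsum]
  refine hmain.trans ?_
  unfold lebesgueFactor
  -- The factor 8 covers both parts: `π + 4 ≤ 8`, and `4 ≤ 8 * (2/π)`.
  have h4 : 1 / 2 ≤ 2 / Real.pi := by
    rw [div_le_div_iff₀ two_pos hp]; linarith [Real.pi_le_four]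
  nlinarith [mul_le_mul_of_nonneg_right h4 hlog, Real.pi_le_four]

end StoMsFEM

/-! ### Polynomial approximation of analytic functions -/

namespace StoMsFEM

open Polynomial Polynomial.Chebyshev Complex

lemma exp_decayRate {τ : ℝ} (hτ : 0 < τ) :
    Real.exp (decayRate τ) = τ + Real.sqrt (1 + τ ^ 2) := by
  unfold decayRate
  rw [Real.exp_log (by positivity), mul_add, mul_one]
  congr 1
  nth_rw 1 [← Real.sqrt_sq hτ.le]
  rw [← Real.sqrt_mul (by positivity)]
  congr 1
  field_simp
  ring

lemma one_lt_exp_decayRate {τ : ℝ} (hτ : 0 < τ) : 1 < Real.exp (decayRate τ) := by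
  rw [exp_decayRate hτ]
  have : 1 ≤ Real.sqrt (1 + τ ^ 2) := Real.one_le_sqrt.mpr (by nlinarith)
  linarith

lemma decayRate_pos {τ : ℝ} (hτ : 0 < τ) : 0 < decayRate τ :=
  Real.one_lt_exp_iff.mp (one_lt_exp_decayRate hτ)

/-- That is, `decayRate τ = arsinh τ`: the semi-minor axis of the corresponding Bernstein ellipse is
exactly `τ`. -/
lemma exp_decayRate_sub_inv {τ : ℝ} (hτ : 0 < τ) :
    Real.exp (decayRate τ) - (Real.exp (decayRate τ))⁻¹ = 2 * τ := by
  have h : (Real.exp (decayRate τ))⁻¹ = Real.sqrt (1 + τ ^ 2) - τ := by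
    rw [inv_eq_iff_eq_inv, eq_comm]
    apply inv_eq_of_mul_eq_one_left
    rw [exp_decayRate hτ]
    have := Real.sq_sqrt (show 0 ≤ 1 + τ ^ 2 by positivity)
    nlinarith
  rw [h, exp_decayRate hτ]; ring

/-- The Joukowski map. -/
noncomputable def joukowski (w : ℂ) : ℂ := (w + w⁻¹) / 2

/-- For `w = r e^{iα}` the difference from `cos α` is `((r + 1/r)/2 - 1) cos α + i ((r - 1/r)/2) sin
α`, and for `r ≥ 1` the first coefficient is at most the second. -/
lemma norm_joukowski_sub_le {w : ℂ} (hw : 1 ≤ ‖w‖) :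
    ‖joukowski w - ((w / ‖w‖).re : ℂ)‖ ≤ (‖w‖ - ‖w‖⁻¹) / 2 := by
  set r := ‖w‖ with hr
  have hr0 : 0 < r := by linarith
  set a := w.re / r
  set b := w.im / r
  have hre : w.re = r * a := by simp only [a]; field_simp
  have him : w.im = r * b := by simp only [b]; field_simp
  have hab : a ^ 2 + b ^ 2 = 1 := by
    have : r ^ 2 = w.re ^ 2 + w.im ^ 2 := by
      rw [hr, Complex.sq_norm, Complex.normSq_apply]; ring
    have h2 : r ^ 2 * (a ^ 2 + b ^ 2) = r ^ 2 * 1 := by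
      rw [mul_one]; nth_rw 2 [this]; rw [hre, him]; ring
    exact mul_left_cancel₀ (by positivity) h2
  have hn : Complex.normSq w = r ^ 2 := by rw [hr, Complex.sq_norm]
  have h1 : (w / (r : ℂ)).re = a := by
    rw [Complex.div_ofReal_re]
  have hr1 : r⁻¹ ≤ 1 := inv_le_one_of_one_le₀ hw
  have hri : r * r⁻¹ = 1 := mul_inv_cancel₀ hr0.ne'
  have e1 : (joukowski w - ((w / (r : ℂ)).re : ℂ)).re = ((r + r⁻¹) / 2 - 1) * a := by
    rw [h1]
    simp only [joukowski, Complex.sub_re, Complex.div_ofNat_re, Complex.add_re, Complex.inv_re,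
      Complex.ofReal_re, hn]
    rw [hre]; field_simp
  have e2 : (joukowski w - ((w / (r : ℂ)).re : ℂ)).im = ((r - r⁻¹) / 2) * b := by
    simp only [joukowski, Complex.sub_im, Complex.div_ofNat_im, Complex.add_im, Complex.inv_im,
      Complex.ofReal_im, hn]
    rw [him]; field_simp; ring
  refine abs_le_of_sq_le_sq' ?_ (by linarith) |>.2
  rw [Complex.sq_norm, Complex.normSq_apply, e1, e2]
  have h3 : ((r + r⁻¹) / 2 - 1) ^ 2 ≤ ((r - r⁻¹) / 2) ^ 2 := by
    nlinarith [mul_nonneg (sub_nonneg.mpr hw) (sub_nonneg.mpr hr1)]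
  nlinarith [mul_le_mul_of_nonneg_right h3 (sq_nonneg a)]

lemma joukowski_mem_complexNhd {τ : ℝ} (hτ : 0 < τ) {w : ℂ} (h1 : 1 ≤ ‖w‖)
    (h2 : ‖w‖ ≤ Real.exp (decayRate τ)) : joukowski w ∈ complexNhd τ := by
  have h0 : 0 < ‖w‖ := by linarith
  have h3 := norm_joukowski_sub_le h1
  have h4 : ((w / ‖w‖).re : ℂ) ∈ (fun t : ℝ => (t : ℂ)) '' Icc (-1) 1 := by
    refine ⟨_, abs_le.mp ((Complex.abs_re_le_norm _).trans ?_), rfl⟩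
    rw [norm_div, Complex.norm_real, norm_norm, div_self h0.ne']
  refine (Metric.infDist_le_dist_of_mem h4).trans ?_
  rw [dist_eq_norm]
  refine h3.trans ?_
  have h5 := exp_decayRate_sub_inv hτ
  have h6 : (Real.exp (decayRate τ))⁻¹ ≤ ‖w‖⁻¹ := by gcongr
  linarith

lemma ofReal_mem_complexNhd {τ : ℝ} (hτ : 0 < τ) {t : ℝ} (ht : t ∈ Icc (-1 : ℝ) 1) :
    (t : ℂ) ∈ complexNhd τ := by
  have h : Metric.infDist (t : ℂ) ((fun t : ℝ => (t : ℂ)) '' Icc (-1) 1) = 0 :=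
    Metric.infDist_zero_of_mem ⟨t, ht, rfl⟩
  simp only [complexNhd, mem_ofPred_eq, h]
  exact hτ.le

lemma isCompact_complexNhd (τ : ℝ) : IsCompact (complexNhd τ) := by
  have hK : IsCompact ((fun t : ℝ => (t : ℂ)) '' Icc (-1) 1) :=
    isCompact_Icc.image Complex.continuous_ofReal
  have hne : ((fun t : ℝ => (t : ℂ)) '' Icc (-1) 1).Nonempty :=
    (nonempty_Icc.mpr (by norm_num)).image _
  have : complexNhd τ = Metric.cthickening τ ((fun t : ℝ => (t : ℂ)) '' Icc (-1) 1) ∨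
      complexNhd τ = ∅ := by
    by_cases hτ : 0 ≤ τ
    · left
      ext z
      rw [Metric.cthickening_eq_preimage_infEDist]
      simp only [complexNhd, mem_ofPred_eq, Metric.infDist, mem_preimage, mem_Iic]
      rw [ENNReal.le_ofReal_iff_toReal_le (Metric.infEDist_ne_top hne) hτ]
    · right
      ext z
      simp only [complexNhd, mem_ofPred_eq, mem_empty_iff_false, iff_false, not_le]
      exact lt_of_lt_of_le (not_le.mp hτ) Metric.infDist_nonneg
  rcases this with h | h
  · rw [h]; exact hK.cthickening
  · rw [h]; exact isCompact_empty

/-- Contour shift for the Laurent coefficients of `f ∘ joukowski`. -/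
lemma norm_circleIntegral_joukowski_le {τ M : ℝ} (hτ : 0 < τ) {f : ℂ → ℂ}
    (hf : AnalyticOnNhd ℂ f (complexNhd τ)) (hM : ∀ z ∈ complexNhd τ, ‖f z‖ ≤ M) (n : ℕ) :
    ‖(2 * Real.pi * I : ℂ)⁻¹ • ∮ w in C(0, 1), (w - 0)⁻¹ • ((w ^ n)⁻¹ * f (joukowski w))‖ ≤
      M * Real.exp (-decayRate τ) ^ n := by
  set ρ := Real.exp (decayRate τ) with hρ
  have hρ1 : 1 < ρ := one_lt_exp_decayRate hτ
  have hdiff : ∀ w : ℂ, 1 ≤ ‖w‖ → ‖w‖ ≤ ρ →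
      DifferentiableAt ℂ (fun w => (w ^ n)⁻¹ * f (joukowski w)) w := by
    intro w h1 h2
    have hw0 : w ≠ 0 := norm_pos_iff.mp (by linarith)
    have hj : DifferentiableAt ℂ joukowski w :=
      (differentiableAt_id.add (differentiableAt_inv hw0)).div_const 2
    exact ((differentiableAt_id.pow n).inv (pow_ne_zero n hw0)).mul
      ((hf _ (joukowski_mem_complexNhd hτ h1 h2)).differentiableAt.comp w hj)
  rw [← circleIntegral_sub_center_inv_smul_eq_of_differentiable_on_annulus_off_countable
    zero_lt_one hρ1.le countable_empty (f := fun w => (w ^ n)⁻¹ * f (joukowski w))]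
  · refine (circleIntegral.norm_two_pi_i_inv_smul_integral_le_of_norm_le_const
      (C := ρ⁻¹ * (ρ⁻¹ ^ n * M)) (by positivity) ?_).trans (le_of_eq ?_)
    · intro w hw
      have hw' : ‖w‖ = ρ := by simpa using hw
      rw [norm_smul, norm_mul, norm_inv, norm_inv, norm_pow, sub_zero, hw', inv_pow]
      gcongr
      exact hM _ (joukowski_mem_complexNhd hτ (by rw [hw']; exact hρ1.le) hw'.le)
    · rw [Real.exp_neg, ← hρ]
      have : ρ ≠ 0 := by positivity
      field_simp
  · intro w hw
    simp only [mem_sdiff, mem_closedBall_zero_iff, mem_ball_zero_iff, not_lt] at hw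
    exact (hdiff w hw.2 hw.1).continuousAt.continuousWithinAt
  · intro w hw
    simp only [mem_sdiff, mem_closedBall_zero_iff, mem_ball_zero_iff, not_le] at hw
    exact hdiff w hw.1.2.le hw.1.1.le

lemma joukowski_exp (θ : ℝ) : joukowski (Complex.exp (θ * I)) = (Real.cos θ : ℂ) := by
  rw [joukowski, ← Complex.exp_neg, Complex.ofReal_cos, Complex.cos]
  congr 2
  ring_nf

/-- Chebyshev expansion, with geometrically decaying coefficients. -/
lemma exists_hasSum_cos {τ M : ℝ} (hτ : 0 < τ) {f : ℂ → ℂ}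
    (hf : AnalyticOnNhd ℂ f (complexNhd τ)) (hM : ∀ z ∈ complexNhd τ, ‖f z‖ ≤ M) :
    ∃ c : ℕ → ℂ, (∀ n, ‖c n‖ ≤ M * Real.exp (-decayRate τ) ^ n) ∧
      ∀ θ : ℝ, HasSum (fun n : ℕ => c n * (2 * Real.cos (n * θ) : ℝ)) (f (Real.cos θ) + c 0) := by
  have : Fact (0 < 2 * Real.pi) := ⟨Real.two_pi_pos⟩
  have hq0 : 0 < Real.exp (-decayRate τ) := Real.exp_pos _
  have hq1 : Real.exp (-decayRate τ) < 1 := Real.exp_lt_one_iff.mpr (by linarith [decayRate_pos hτ])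
  let F : C(AddCircle (2 * Real.pi), ℂ) :=
    { toFun := fun x => f (((AddCircle.toCircle x : ℂ).re : ℝ) : ℂ)
      continuous_toFun := by
        have h1 : Continuous fun x : AddCircle (2 * Real.pi) =>
            (((AddCircle.toCircle x : ℂ).re : ℝ) : ℂ) := by
          have := AddCircle.continuous_toCircle (T := 2 * Real.pi)
          fun_prop
        refine hf.continuousOn.comp_continuous h1 fun x => ofReal_mem_complexNhd hτ ?_
        exact abs_le.mp ((Complex.abs_re_le_norm _).trans_eq (Circle.norm_coe _)) }
  have hFval : ∀ θ : ℝ, F (θ : AddCircle (2 * Real.pi)) = f (Real.cos θ) := by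
    intro θ
    change f (((AddCircle.toCircle (θ : AddCircle (2 * Real.pi)) : ℂ).re : ℝ) : ℂ) = _
    rw [AddCircle.toCircle_apply_mk, div_self Real.two_pi_pos.ne', one_mul, Circle.coe_exp,
      Complex.exp_ofReal_mul_I_re]
  have hFeven : ∀ x, F (-x) = F x := by
    intro x
    induction x using QuotientAddGroup.induction_on with
    | H θ => rw [← AddCircle.coe_neg, hFval, hFval, Real.cos_neg]
  -- On the unit circle the Joukowski map is `cos θ`, so the Fourier coefficient is a contour
  -- integral of an analytic integrand and the contour can be moved outwards.
  have hcoef : ∀ n : ℕ, fourierCoeff F n = (2 * Real.pi * I : ℂ)⁻¹ •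
      ∮ w in C(0, 1), (w - 0)⁻¹ • ((w ^ n)⁻¹ * f (joukowski w)) := by
    intro n
    rw [fourierCoeff_eq_intervalIntegral F n 0, zero_add, circleIntegral]
    rw [← intervalIntegral.integral_smul, ← intervalIntegral.integral_smul]
    refine intervalIntegral.integral_congr fun θ _ => ?_
    simp only [hFval, fourier_coe_apply, deriv_circleMap, circleMap, zero_add, ofReal_one,
      one_mul, sub_zero, joukowski_exp, smul_eq_mul, Complex.real_smul]
    have h1 : (2 * (Real.pi : ℂ) * I * ((-(n : ℤ) : ℤ) : ℂ) * (θ : ℂ) / ((2 * Real.pi : ℝ) : ℂ)) =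
        -((n : ℂ) * (θ * I)) := by
      have := Real.pi_ne_zero
      push_cast
      field_simp
    rw [h1, Complex.exp_neg, Complex.exp_nat_mul]
    have h2 := Complex.exp_ne_zero (θ * I)
    have h3 : (Real.pi : ℂ) ≠ 0 := by exact_mod_cast Real.pi_ne_zero
    push_cast
    field_simp
  have hneg : ∀ n : ℤ, fourierCoeff F (-n) = fourierCoeff F n := by
    intro n
    rw [fourierCoeff, fourierCoeff, ← integral_neg_eq_self]
    refine integral_congr_ae (Filter.Eventually.of_forall fun x => ?_)
    simp only [hFeven]
    congr 1
    simp [fourier_apply]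
  have hbound : ∀ n : ℕ, ‖fourierCoeff F n‖ ≤ M * Real.exp (-decayRate τ) ^ n := by
    intro n; rw [hcoef]; exact norm_circleIntegral_joukowski_le hτ hf hM n
  have hgeo : Summable fun n : ℕ => M * Real.exp (-decayRate τ) ^ n :=
    (summable_geometric_of_lt_one hq0.le hq1).mul_left M
  have hs1 : Summable fun n : ℕ => fourierCoeff F (n : ℤ) :=
    Summable.of_norm_bounded hgeo hbound
  have hsum : Summable (fourierCoeff F) := by
    refine Summable.of_nat_of_neg hs1 ?_
    simpa only [hneg] using hs1
  refine ⟨fun n => fourierCoeff F n, hbound, fun θ => ?_⟩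
  have h := (has_pointwise_sum_fourier_series_of_summable hsum (θ : AddCircle (2 * Real.pi)))
  -- Pairing `n` with `-n` produces `2 cos(nθ)` and counts the zeroth term twice; this is the extra
  -- `c 0` in the sum.
  have h2 := h.nat_add_neg
  rw [hFval] at h2
  convert h2 using 1
  · ext n
    rw [hneg, ← smul_add, smul_eq_mul]
    congr 1
    rw [fourier_coe_apply, fourier_coe_apply]
    push_cast
    rw [Complex.two_cos]
    have h3 : (Real.pi : ℂ) ≠ 0 := by exact_mod_cast Real.pi_ne_zero
    congr 2 <;> field_simp
  · simp

/-- Bernstein's theorem: geometric rate of polynomial approximation on `[-1,1]` of a function that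
is analytic on a neighbourhood of `Σ([-1,1]; τ)`. -/
theorem exists_polynomial_approx {τ M : ℝ} (hτ : 0 < τ) {f : ℂ → ℂ}
    (hf : AnalyticOnNhd ℂ f (complexNhd τ)) (hM : ∀ z ∈ complexNhd τ, ‖f z‖ ≤ M)
    {g : ℝ → ℝ} (hfg : ∀ t ∈ Icc (-1 : ℝ) 1, f t = (g t : ℂ)) (n : ℕ) :
    ∃ p : ℝ[X], p.natDegree ≤ n ∧ ∀ t ∈ Icc (-1 : ℝ) 1,
      |g t - p.eval t| ≤
        2 * M / (1 - Real.exp (-decayRate τ)) * Real.exp (-decayRate τ * n) := by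
  obtain ⟨c, hc, hsum⟩ := exists_hasSum_cos hτ hf hM
  set q := Real.exp (-decayRate τ) with hq
  have hq0 : 0 < q := Real.exp_pos _
  have hq1 : q < 1 := Real.exp_lt_one_iff.mpr (by linarith [decayRate_pos hτ])
  have hM0 : 0 ≤ M := (norm_nonneg _).trans (hM _ (ofReal_mem_complexNhd hτ
    (t := 0) (by norm_num)))
  -- The truncated Chebyshev series; `c 0` is subtracted because the sum counts it twice, and real
  -- parts suffice as `g` is real.
  refine ⟨∑ k ∈ Finset.range (n + 1), Polynomial.C (2 * (c k).re) * T ℝ k -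
    Polynomial.C (c 0).re, ?_, ?_⟩
  · rw [Polynomial.natDegree_sub_C]
    refine Polynomial.natDegree_sum_le_of_forall_le _ _ fun k hk => ?_
    refine (Polynomial.natDegree_C_mul_le _ _).trans ?_
    rw [natDegree_T, Int.natAbs_natCast]
    exact Nat.lt_succ_iff.mp (Finset.mem_range.mp hk)
  · intro t ht
    obtain ⟨θ, rfl⟩ : ∃ θ, Real.cos θ = t := ⟨Real.arccos t, Real.cos_arccos ht.1 ht.2⟩
    have h1 := Complex.hasSum_re (hsum θ)
    rw [hfg _ ht] at h1
    simp only [Complex.re_mul_ofReal, Complex.add_re, Complex.ofReal_re] at h1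
    have h2 := (hasSum_nat_add_iff' (n + 1)).mpr h1
    have h3 : g (Real.cos θ) - (∑ k ∈ Finset.range (n + 1), Polynomial.C (2 * (c k).re) * T ℝ k -
        Polynomial.C (c 0).re).eval (Real.cos θ) = g (Real.cos θ) + (c 0).re -
        ∑ i ∈ Finset.range (n + 1), (c i).re * (2 * Real.cos (i * θ)) := by
      rw [Polynomial.eval_sub, Polynomial.eval_finsetSum, Polynomial.eval_C]
      simp only [Polynomial.eval_mul, Polynomial.eval_C, T_real_cos, Int.cast_natCast]
      rw [sub_sub_eq_add_sub]
      congr 1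
      exact Finset.sum_congr rfl fun i _ => by ring
    have h4 : HasSum (fun i : ℕ => 2 * M * q ^ (n + 1) * q ^ i)
        (2 * M * q ^ (n + 1) * (1 - q)⁻¹) :=
      (hasSum_geometric_of_lt_one hq0.le hq1).mul_left _
    have h5 := tsum_of_norm_bounded h4 (f := fun i : ℕ =>
      (c (i + (n + 1))).re * (2 * Real.cos (↑(i + (n + 1)) * θ))) fun i => by
        rw [norm_mul, norm_mul, Real.norm_eq_abs, Real.norm_eq_abs, Real.norm_eq_abs]
        have a1 := (Complex.abs_re_le_norm (c (i + (n + 1)))).trans (hc _)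
        have a2 := Real.abs_cos_le_one (↑(i + (n + 1)) * θ)
        calc _ ≤ (M * q ^ (i + (n + 1))) * (|2| * 1) := by gcongr
          _ = _ := by rw [abs_two]; ring
    rw [h2.tsum_eq] at h5
    rw [h3, ← Real.norm_eq_abs]
    refine h5.trans ?_
    have h6 : Real.exp (-decayRate τ * n) = q ^ n := by
      rw [hq, ← Real.exp_nat_mul]; congr 1; ring
    rw [h6, pow_succ, div_eq_mul_inv]
    have h7 : 0 < (1 - q)⁻¹ := inv_pos.mpr (by linarith)
    calc 2 * M * (q ^ n * q) * (1 - q)⁻¹ ≤ 2 * M * (q ^ n * 1) * (1 - q)⁻¹ := by gcongr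
      _ = _ := by ring

end StoMsFEM

/-! ### Error of tensor-product interpolation -/

namespace StoMsFEM

open Polynomial

/-- The Lagrange basis polynomials at the Chebyshev nodes, evaluated at a point. -/
noncomputable abbrev chebyshevBasis (n : ℕ) (j : Fin (n + 1)) (x : ℝ) : ℝ :=
  (Lagrange.basis Finset.univ (chebyshevNode n) j).eval x

lemma sum_chebyshevBasis (n : ℕ) (x : ℝ) : ∑ j, chebyshevBasis n j x = 1 := by
  rw [← Polynomial.eval_finsetSum, Lagrange.sum_basis (chebyshevNode_injective n).injOn
    Finset.univ_nonempty, Polynomial.eval_one]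

lemma sum_eval_mul_chebyshevBasis {n : ℕ} {p : ℝ[X]} (hp : p.natDegree ≤ n) (x : ℝ) :
    ∑ j, p.eval (chebyshevNode n j) * chebyshevBasis n j x = p.eval x := by
  have h := Lagrange.eq_interpolate (s := Finset.univ) (v := chebyshevNode n) (f := p)
    (chebyshevNode_injective n).injOn (by
      rw [Finset.card_univ, Fintype.card_fin]
      exact lt_of_le_of_lt Polynomial.degree_le_natDegree (by exact_mod_cast Nat.lt_succ_of_le hp))
  conv_rhs => rw [h]
  rw [Lagrange.interpolate_apply, Polynomial.eval_finsetSum]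
  simp

section

variable {K : ℕ} (ν : Fin K → ℕ)

/-- The point whose coordinates in `s` are those of a Chebyshev node, and the others those
of `ξ`. -/
noncomputable def mixedPoint (s : Finset (Fin K)) (ξ : Fin K → ℝ)
    (j : (k : Fin K) → Fin (ν k + 1)) : Fin K → ℝ :=
  fun k => if k ∈ s then chebyshevNode (ν k) (j k) else ξ k

/-- Interpolation in the directions `k ∈ s` only. -/
noncomputable def partialInterpolant (s : Finset (Fin K)) (f : (Fin K → ℝ) → ℝ)
    (ξ : Fin K → ℝ) : ℝ :=
  ∑ j : (k : Fin K) → Fin (ν k + 1),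
    f (mixedPoint ν s ξ j) * ∏ k, chebyshevBasis (ν k) (j k) (ξ k)

lemma mixedPoint_mem {s : Finset (Fin K)} {ξ : Fin K → ℝ} (hξ : ξ ∈ paramCube K)
    (j : (k : Fin K) → Fin (ν k + 1)) : mixedPoint ν s ξ j ∈ paramCube K := by
  intro k
  unfold mixedPoint
  split_ifs
  · exact chebyshevNode_mem _ _
  · exact hξ k

/-- The definition keeps all basis factors, also in directions that are not interpolated; there they
sum to 1 and drop out. -/
lemma partialInterpolant_empty (f : (Fin K → ℝ) → ℝ) (ξ : Fin K → ℝ) :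
    partialInterpolant ν ∅ f ξ = f ξ := by
  have h : ∀ j, mixedPoint ν ∅ ξ j = ξ := fun j => by ext k; simp [mixedPoint]
  simp only [partialInterpolant, h]
  rw [← Finset.mul_sum, ← Fintype.prod_sum (fun k a => chebyshevBasis (ν k) a (ξ k))]
  simp only [sum_chebyshevBasis, Finset.prod_const_one, mul_one]

lemma partialInterpolant_univ (f : (Fin K → ℝ) → ℝ) (ξ : Fin K → ℝ) :
    partialInterpolant ν Finset.univ f ξ = chebyshevInterpolant ν f ξ := by
  have h : ∀ j, mixedPoint ν Finset.univ ξ j = fun k => chebyshevNode (ν k) (j k) :=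
    fun j => by ext k; simp [mixedPoint]
  simp only [partialInterpolant, h, chebyshevInterpolant]

lemma mixedPoint_insert {s : Finset (Fin K)} {k : Fin K} (hk : k ∉ s) (ξ : Fin K → ℝ)
    (j : (k : Fin K) → Fin (ν k + 1)) :
    mixedPoint ν (insert k s) ξ j =
      Function.update (mixedPoint ν s ξ j) k (chebyshevNode (ν k) (j k)) := by
  ext i
  by_cases hi : i = k
  · subst hi; simp [mixedPoint]
  · simp [mixedPoint, hi]

lemma update_mixedPoint_self {s : Finset (Fin K)} {k : Fin K} (hk : k ∉ s) (ξ : Fin K → ℝ)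
    (j : (k : Fin K) → Fin (ν k + 1)) :
    Function.update (mixedPoint ν s ξ j) k (ξ k) = mixedPoint ν s ξ j := by
  rw [Function.update_eq_self_iff]
  simp [mixedPoint, hk]

/-- Interpolation in one direction reproduces polynomials in that direction. -/
lemma sum_eval_sub_mul_prod_eq_zero {s : Finset (Fin K)} {k : Fin K} (hk : k ∉ s) (ξ : Fin K → ℝ)
    {P : (Fin K → ℝ) → ℝ[X]} (hP : ∀ j, (P (mixedPoint ν s ξ j)).natDegree ≤ ν k) :
    ∑ j : (k : Fin K) → Fin (ν k + 1),
      ((P (mixedPoint ν s ξ j)).eval (chebyshevNode (ν k) (j k)) -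
        (P (mixedPoint ν s ξ j)).eval (ξ k)) * ∏ i, chebyshevBasis (ν i) (j i) (ξ i) = 0 := by
  rw [← (Equiv.piSplitAt k fun i => Fin (ν i + 1)).symm.sum_comp, Fintype.sum_prod_type_right]
  refine Finset.sum_eq_zero fun w _ => ?_
  -- As `k ∉ s`, the mixed point ignores the index in direction `k`. With the other indices fixed,
  -- the inner sum therefore involves a single polynomial.
  have hmix : ∀ a b : Fin (ν k + 1),
      mixedPoint ν s ξ ((Equiv.piSplitAt k fun i => Fin (ν i + 1)).symm (a, w)) =
      mixedPoint ν s ξ ((Equiv.piSplitAt k fun i => Fin (ν i + 1)).symm (b, w)) := by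
    intro a b
    ext i
    by_cases hi : i = k
    · subst hi; simp [mixedPoint, hk]
    · simp [mixedPoint, Equiv.piSplitAt, hi]
  set p := P (mixedPoint ν s ξ ((Equiv.piSplitAt k fun i => Fin (ν i + 1)).symm (0, w))) with hp
  have hterm : ∀ a : Fin (ν k + 1),
      ((P (mixedPoint ν s ξ ((Equiv.piSplitAt k fun i => Fin (ν i + 1)).symm (a, w)))).eval
        (chebyshevNode (ν k) ((Equiv.piSplitAt k fun i => Fin (ν i + 1)).symm (a, w) k)) -
      (P (mixedPoint ν s ξ ((Equiv.piSplitAt k fun i => Fin (ν i + 1)).symm (a, w)))).eval (ξ k)) *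
        ∏ i, chebyshevBasis (ν i) ((Equiv.piSplitAt k fun i => Fin (ν i + 1)).symm (a, w) i) (ξ i) =
      (p.eval (chebyshevNode (ν k) a) * chebyshevBasis (ν k) a (ξ k) -
        p.eval (ξ k) * chebyshevBasis (ν k) a (ξ k)) *
        ∏ i : {i // i ≠ k}, chebyshevBasis (ν i) (w i) (ξ i) := by
    intro a
    rw [hmix a 0, ← hp, Fintype.prod_eq_mul_prod_subtype_ne _ k]
    have h1 : (Equiv.piSplitAt k fun i => Fin (ν i + 1)).symm (a, w) k = a := by simp
    have h2 : ∀ i : {i // i ≠ k},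
        (Equiv.piSplitAt k fun i => Fin (ν i + 1)).symm (a, w) i = w i := by
      rintro ⟨i, hi⟩; simp [Equiv.piSplitAt, hi]
    simp only [h1, h2]
    ring
  simp only [hterm]
  rw [← Finset.sum_mul, Finset.sum_sub_distrib, sum_eval_mul_chebyshevBasis (hP _),
    ← Finset.mul_sum, sum_chebyshevBasis, mul_one, sub_self, zero_mul]

lemma sum_abs_prod_chebyshevBasis_le {Λ : Fin K → ℝ}
    (hΛ : ∀ k, ∀ x ∈ Icc (-1 : ℝ) 1, ∑ j, |chebyshevBasis (ν k) j x| ≤ Λ k)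
    {ξ : Fin K → ℝ} (hξ : ξ ∈ paramCube K) :
    ∑ j : (k : Fin K) → Fin (ν k + 1), |∏ k, chebyshevBasis (ν k) (j k) (ξ k)| ≤ ∏ k, Λ k := by
  simp only [Finset.abs_prod]
  rw [← Fintype.prod_sum (fun k a => |chebyshevBasis (ν k) a (ξ k)|)]
  exact Finset.prod_le_prod (fun k _ => Finset.sum_nonneg fun _ _ => abs_nonneg _)
    fun k _ => hΛ k _ (hξ k)

variable {ν} in
-- Because interpolation in direction `k` reproduces polynomials, `f` may be replaced by `f - p`
-- along each line. The node value and the point value each cost `E`, and the weights have total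
-- mass at most `∏ Λ`.
lemma abs_partialInterpolant_insert_sub_le {s : Finset (Fin K)} {k : Fin K} (hk : k ∉ s)
    {Λ : Fin K → ℝ} (hΛ : ∀ k, ∀ x ∈ Icc (-1 : ℝ) 1, ∑ j, |chebyshevBasis (ν k) j x| ≤ Λ k)
    {f : (Fin K → ℝ) → ℝ} {E : ℝ}
    (hf : ∀ y ∈ paramCube K, ∃ p : ℝ[X], p.natDegree ≤ ν k ∧
      ∀ t ∈ Icc (-1 : ℝ) 1, |f (Function.update y k t) - p.eval t| ≤ E)
    {ξ : Fin K → ℝ} (hξ : ξ ∈ paramCube K) :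
    |partialInterpolant ν (insert k s) f ξ - partialInterpolant ν s f ξ| ≤ 2 * E * ∏ k, Λ k := by
  classical
  choose! P hPdeg hP using hf
  have hE : 0 ≤ E := (abs_nonneg _).trans (hP ξ hξ 0 (by norm_num))
  have hzero := sum_eval_sub_mul_prod_eq_zero ν hk ξ (P := P)
    fun j => hPdeg _ (mixedPoint_mem ν hξ j)
  rw [partialInterpolant, partialInterpolant, ← Finset.sum_sub_distrib, ← sub_zero (Finset.sum _ _),
    ← hzero, ← Finset.sum_sub_distrib]
  refine (Finset.abs_sum_le_sum_abs _ _).trans ?_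
  refine le_trans (Finset.sum_le_sum fun j _ => ?_) (le_trans (le_of_eq (Finset.mul_sum _ _ _).symm)
    (mul_le_mul_of_nonneg_left (sum_abs_prod_chebyshevBasis_le ν hΛ hξ) (by positivity)))
  set y := mixedPoint ν s ξ j with hy
  have hyc : y ∈ paramCube K := mixedPoint_mem ν hξ j
  have h1 := hP y hyc _ (chebyshevNode_mem (ν k) (j k))
  have h2 := hP y hyc _ (hξ k)
  rw [update_mixedPoint_self ν hk] at h2
  rw [mixedPoint_insert ν hk, ← hy, ← sub_mul, ← sub_mul, abs_mul]
  gcongr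
  have h3 : f (Function.update y k (chebyshevNode (ν k) (j k))) - f y -
      ((P y).eval (chebyshevNode (ν k) (j k)) - (P y).eval (ξ k)) =
      (f (Function.update y k (chebyshevNode (ν k) (j k))) -
        (P y).eval (chebyshevNode (ν k) (j k))) - (f y - (P y).eval (ξ k)) := by ring
  rw [h3]
  refine (abs_sub _ _).trans ?_
  linarith

variable {ν} in
/-- Error of tensor-product interpolation in terms of one-dimensional approximation errors. -/
theorem abs_sub_chebyshevInterpolant_le {Λ : Fin K → ℝ}
    (hΛ : ∀ k, ∀ x ∈ Icc (-1 : ℝ) 1, ∑ j, |chebyshevBasis (ν k) j x| ≤ Λ k)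
    {f : (Fin K → ℝ) → ℝ} {E : Fin K → ℝ}
    (hf : ∀ k, ∀ y ∈ paramCube K, ∃ p : ℝ[X], p.natDegree ≤ ν k ∧
      ∀ t ∈ Icc (-1 : ℝ) 1, |f (Function.update y k t) - p.eval t| ≤ E k)
    {ξ : Fin K → ℝ} (hξ : ξ ∈ paramCube K) :
    |f ξ - chebyshevInterpolant ν f ξ| ≤ 2 * (∏ k, Λ k) * ∑ k, E k := by
  classical
  have key : ∀ s : Finset (Fin K),
      |partialInterpolant ν s f ξ - f ξ| ≤ ∑ k ∈ s, 2 * E k * ∏ k, Λ k := by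
    intro s
    induction s using Finset.induction_on with
    | empty => simp [partialInterpolant_empty]
    | insert k s hk ih =>
      rw [Finset.sum_insert hk]
      have := abs_partialInterpolant_insert_sub_le hk hΛ (hf k) hξ
      calc _ = |(partialInterpolant ν (insert k s) f ξ - partialInterpolant ν s f ξ) +
            (partialInterpolant ν s f ξ - f ξ)| := by ring_nf
        _ ≤ _ := (abs_add_le _ _).trans (add_le_add this ih)
  have := key Finset.univ
  rw [partialInterpolant_univ, abs_sub_comm] at this
  refine this.trans (le_of_eq ?_)
  rw [← Finset.sum_mul, ← Finset.mul_sum]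
  ring

/-- Error of tensor-product Chebyshev interpolation of a function with analytic extensions. -/
theorem exists_abs_sub_chebyshevInterpolant_le {S : (Fin K → ℝ) → ℝ} {τ : Fin K → ℝ}
    (hτ : ∀ k, 0 < τ k) (hS : ∀ k, HasAnalyticExtension S k (τ k)) :
    ∃ Cs : ℝ, 0 < Cs ∧ ∀ ν : Fin K → ℕ, ∀ ξ ∈ paramCube K,
      |S ξ - chebyshevInterpolant ν S ξ| ≤ Cs *
        (∏ k, (2 / Real.pi * Real.log ((ν k : ℝ) + 1) + 1)) *
          ∑ k, Real.exp (-(decayRate (τ k)) * (ν k : ℝ)) := by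
  choose F hF hFS using hS
  have hbd : ∀ k, ∃ M : ℝ, ∀ z ∈ complexNhd (τ k), ‖F k z‖ ≤ M := fun k =>
    (isCompact_complexNhd (τ k)).exists_bound_of_continuousOn (hF k).continuousOn
  choose M hM using hbd
  have hM0 : ∀ k, 0 ≤ M k := fun k =>
    (norm_nonneg _).trans (hM k _ (ofReal_mem_complexNhd (hτ k) (t := 0) (by norm_num)))
  have hq1 : ∀ k, 0 < 1 - Real.exp (-decayRate (τ k)) := fun k => by
    have := Real.exp_lt_one_iff.mpr (by linarith [decayRate_pos (hτ k)] : -decayRate (τ k) < 0)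
    linarith
  set B : Fin K → ℝ := fun k => 2 * M k / (1 - Real.exp (-decayRate (τ k)))
  have hB : ∀ k, 0 ≤ B k := fun k => div_nonneg (by linarith [hM0 k]) (hq1 k).le
  -- `8 ^ K` comes from the Lebesgue constants; `1 + ∑ B` dominates every `B k` and keeps the
  -- constant positive when all of them vanish.
  refine ⟨2 * 8 ^ K * (1 + ∑ k, B k), ?_, fun ν ξ hξ => ?_⟩
  · have := Finset.sum_nonneg fun k (_ : k ∈ Finset.univ) => hB k
    positivity
  have happ : ∀ k, ∀ y ∈ paramCube K, ∃ p : ℝ[X], p.natDegree ≤ ν k ∧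
      ∀ t ∈ Icc (-1 : ℝ) 1, |S (Function.update y k t) - p.eval t| ≤
        B k * Real.exp (-decayRate (τ k) * ν k) := by
    intro k y hy
    let η : {j : Fin K // j ≠ k} → Icc (-1 : ℝ) 1 := fun j => ⟨y j, hy j⟩
    have hins : ∀ t, insertParam k t η = Function.update y k t := by
      intro t; ext j
      by_cases hj : j = k
      · subst hj; simp [insertParam]
      · simp [insertParam, hj, η]
    refine exists_polynomial_approx (hτ k) (f := fun z => F k z η) (M := M k) ?_ ?_ ?_ (ν k)
    -- Evaluation at `η` is continuous and linear, so it preserves analyticity, and the sup norm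
    -- gives one bound `M k` for all `η`.
    · exact fun z hz => AnalyticAt.comp (g := ContinuousMap.evalCLM ℂ η)
        ((ContinuousMap.evalCLM ℂ η).analyticAt (F k z)) (hF k z hz)
    · exact fun z hz => ((F k z).norm_coe_le_norm η).trans (hM k z hz)
    · intro t ht
      rw [hFS k t ht η, hins]
  have h := abs_sub_chebyshevInterpolant_le (Λ := fun k => 8 * lebesgueFactor (ν k))
    (fun k x hx => sum_abs_eval_basis_le (ν k) hx) happ hξ
  refine h.trans ?_
  rw [Finset.prod_mul_distrib, Finset.prod_const, Finset.card_univ, Fintype.card_fin]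
  have hprod : 0 ≤ ∏ k, lebesgueFactor (ν k) :=
    Finset.prod_nonneg fun k _ => zero_le_one.trans (one_le_lebesgueFactor _)
  have hsum : ∑ k, B k * Real.exp (-decayRate (τ k) * ν k) ≤
      (1 + ∑ k, B k) * ∑ k, Real.exp (-decayRate (τ k) * ν k) := by
    rw [Finset.mul_sum]
    refine Finset.sum_le_sum fun k _ => ?_
    have := Finset.single_le_sum (fun i _ => hB i) (Finset.mem_univ k)
    gcongr
    linarith
  calc 2 * (8 ^ K * ∏ k, lebesgueFactor (ν k)) *
        ∑ k, B k * Real.exp (-decayRate (τ k) * ν k)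
      ≤ 2 * (8 ^ K * ∏ k, lebesgueFactor (ν k)) *
        ((1 + ∑ k, B k) * ∑ k, Real.exp (-decayRate (τ k) * ν k)) := by gcongr
    _ = 2 * 8 ^ K * (1 + ∑ k, B k) * (∏ k, lebesgueFactor (ν k)) *
        ∑ k, Real.exp (-decayRate (τ k) * ν k) := by ring
    _ = _ := rfl

end

end StoMsFEM

/-! ### Analytic extension from local power series expansions -/

namespace StoMsFEM

open Filter Topology

section

variable {X : Type*} [TopologicalSpace X] {S : ℝ → X → ℝ} {a : ℝ → ℕ → X → ℝ} {R C : ℝ}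

lemma abs_sub_sum_range_le {b : ℕ → ℝ} {x s : ℝ} (hR : 0 < R)
    (hb : ∀ n, |b n| ≤ C * R ^ n) (hx : |x| * R ≤ 1 / 2) (hs : HasSum (fun n => b n * x ^ n) s)
    (n : ℕ) : |s - ∑ m ∈ Finset.range n, b m * x ^ m| ≤ 2 * C * R ^ n * |x| ^ n := by
  have h1 := (hasSum_nat_add_iff' n).mpr hs
  have h2 : HasSum (fun i : ℕ => C * R ^ n * |x| ^ n * (|x| * R) ^ i)
      (C * R ^ n * |x| ^ n * (1 - |x| * R)⁻¹) :=
    (hasSum_geometric_of_lt_one (by positivity) (by linarith)).mul_left _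
  have h3 := tsum_of_norm_bounded h2 (f := fun i : ℕ => b (i + n) * x ^ (i + n)) fun i => by
    rw [norm_mul, norm_pow, Real.norm_eq_abs, Real.norm_eq_abs]
    calc _ ≤ C * R ^ (i + n) * |x| ^ (i + n) := by gcongr; exact hb _
      _ = _ := by ring
  rw [h1.tsum_eq, Real.norm_eq_abs] at h3
  have hC : 0 ≤ C := by simpa using (abs_nonneg _).trans (hb 0)
  refine h3.trans ?_
  have h4 : (1 - |x| * R)⁻¹ ≤ 2 := by
    rw [inv_le_comm₀ (by linarith) two_pos]; linarith
  calc _ ≤ C * R ^ n * |x| ^ n * 2 := by gcongr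
    _ = _ := by ring

/-- The coefficients of uniformly convergent expansions of continuous functions are continuous. -/
lemma continuous_coeff (hR : 0 < R) {t₀ : ℝ} (ht₀ : t₀ ∈ Icc (-1 : ℝ) 1)
    {b : ℕ → X → ℝ} (hb : ∀ n η, |b n η| ≤ C * R ^ n)
    (hsum : ∀ t ∈ Icc (-1 : ℝ) 1, |t - t₀| * R < 1 → ∀ η,
      HasSum (fun n => b n η * (t - t₀) ^ n) (S t η))
    (hcont : ∀ t ∈ Icc (-1 : ℝ) 1, Continuous (S t)) (n : ℕ) : Continuous (b n) := by
  induction n using Nat.strong_induction_on with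
  | _ n ih =>
  rcases isEmpty_or_nonempty X with hX | ⟨⟨η₀⟩⟩
  · exact continuous_of_discreteTopology
  have hC : 0 ≤ C := by simpa using (abs_nonneg _).trans (hb 0 η₀)
  -- Subtracting the earlier terms and dividing by `(t - t₀)^n` gives a function continuous in `η`
  -- by induction, within `O(|t - t₀|)` of `b n` uniformly in `η`.
  refine continuous_of_uniform_approx_of_continuous fun u hu => ?_
  obtain ⟨ε, hε, hεu⟩ := Metric.mem_uniformity_dist.mp hu
  obtain ⟨δ, hδ0, hδ1, hδR, hδε⟩ : ∃ δ : ℝ, 0 < δ ∧ δ ≤ 1 ∧ δ * R ≤ 1 / 2 ∧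
      2 * C * R ^ (n + 1) * δ < ε := by
    have hD : 0 < 2 * C * R ^ (n + 1) + 1 := by positivity
    refine ⟨min 1 (min (1 / 2 / R) (ε / (2 * C * R ^ (n + 1) + 1))), by positivity,
      min_le_left _ _, ?_, ?_⟩
    · rw [← le_div_iff₀ hR]
      exact (min_le_right _ _).trans (min_le_left _ _)
    · set δ := min 1 (min (1 / 2 / R) (ε / (2 * C * R ^ (n + 1) + 1)))
      have h1 : δ ≤ ε / (2 * C * R ^ (n + 1) + 1) := (min_le_right _ _).trans (min_le_right _ _)
      have h0 : 0 < δ := by positivity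
      rw [le_div_iff₀ hD] at h1
      nlinarith
  -- Stepping towards `0` by `δ ≤ 1` stays inside `[-1,1]`.
  obtain ⟨t, ht, htt⟩ : ∃ t ∈ Icc (-1 : ℝ) 1, |t - t₀| = δ := by
    rcases le_total t₀ 0 with h | h
    · exact ⟨t₀ + δ, ⟨by linarith [ht₀.1], by linarith⟩, by
        rw [add_sub_cancel_left, abs_of_pos hδ0]⟩
    · exact ⟨t₀ - δ, ⟨by linarith, by linarith [ht₀.2]⟩, by
        rw [sub_sub_cancel_left, abs_neg, abs_of_pos hδ0]⟩
  have htne : t - t₀ ≠ 0 := by rw [← abs_pos, htt]; exact hδ0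
  refine ⟨fun η => (S t η - ∑ m ∈ Finset.range n, b m η * (t - t₀) ^ m) / (t - t₀) ^ n, ?_, ?_⟩
  · refine Continuous.div_const ((hcont t ht).sub (continuous_finsetSum _ fun m hm => ?_)) _
    exact (ih m (Finset.mem_range.mp hm)).mul continuous_const
  · intro η
    refine hεu ?_
    have h := abs_sub_sum_range_le hR (fun n => hb n η) (by rw [htt]; exact hδR)
      (hsum t ht (by rw [htt]; linarith) η) (n + 1)
    rw [Finset.sum_range_succ, htt] at h
    rw [dist_comm, Real.dist_eq]
    have h2 : (S t η - ∑ m ∈ Finset.range n, b m η * (t - t₀) ^ m) / (t - t₀) ^ n - b n η =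
        (S t η - (∑ m ∈ Finset.range n, b m η * (t - t₀) ^ m + b n η * (t - t₀) ^ n)) /
          (t - t₀) ^ n := by
      field_simp
      ring
    rw [h2, abs_div, abs_pow, htt, div_lt_iff₀ (by positivity)]
    calc _ ≤ _ := h
      _ = 2 * C * R ^ (n + 1) * δ * δ ^ n := by ring
      _ < _ := by gcongr

end

/-! ### Power series at real points and their gluing -/

section

variable {E : Type*} [NormedAddCommGroup E] [NormedSpace ℂ E] {R C : ℝ}

/-- The sum of the power series with coefficients `A` centred at the real point `t`. -/
noncomputable def seriesAt (A : ℕ → E) (t : ℝ) (z : ℂ) : E := ∑' n, (z - t) ^ n • A n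

lemma norm_seriesAt_term_le {A : ℕ → E} (hA : ∀ n, ‖A n‖ ≤ C * R ^ n) (z : ℂ)
    (n : ℕ) : ‖z ^ n • A n‖ ≤ C * (‖z‖ * R) ^ n := by
  rw [norm_smul, norm_pow]
  calc _ ≤ ‖z‖ ^ n * (C * R ^ n) := by gcongr; exact hA n
    _ = _ := by ring

lemma hasSum_seriesAt [CompleteSpace E] (hR : 0 < R) {A : ℕ → E} (hA : ∀ n, ‖A n‖ ≤ C * R ^ n)
    {t : ℝ} {z : ℂ} (hz : ‖z - t‖ * R < 1) :
    HasSum (fun n => (z - t) ^ n • A n) (seriesAt A t z) := by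
  refine Summable.hasSum (Summable.of_norm_bounded
    ((summable_geometric_of_lt_one (by positivity) hz).mul_left C)
    fun n => norm_seriesAt_term_le hA _ n)

lemma analyticAt_seriesAt [CompleteSpace E] (hR : 0 < R) {A : ℕ → E}
    (hA : ∀ n, ‖A n‖ ≤ C * R ^ n) {t : ℝ} {z : ℂ} (hz : ‖z - t‖ * R < 1) :
    AnalyticAt ℂ (seriesAt A t) z := by
  have hC : 0 ≤ C := by simpa using (norm_nonneg _).trans (hA 0)
  obtain ⟨r, hr1, hr2⟩ := exists_between ((lt_div_iff₀ hR).mpr hz)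
  have hr0 : 0 ≤ r := (norm_nonneg _).trans hr1.le
  have hd : DifferentiableOn ℂ (seriesAt A t) (Metric.ball (t : ℂ) r) := by
    refine Complex.differentiableOn_tsum_of_summable_norm (u := fun n => C * (r * R) ^ n)
      ((summable_geometric_of_lt_one (by positivity) ((lt_div_iff₀ hR).mp hr2)).mul_left C)
      (fun n => ?_) Metric.isOpen_ball fun n w hw => ?_
    · exact (((differentiable_id.sub_const _).pow n).smul_const _).differentiableOn
    · refine (norm_seriesAt_term_le hA _ n).trans ?_
      have : ‖w - t‖ ≤ r := (mem_ball_iff_norm.mp hw).le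
      gcongr
  exact hd.analyticAt (Metric.isOpen_ball.mem_nhds (mem_ball_iff_norm.mpr hr1))

/-- Expansions around two points of `[-1,1]` that have the same sum on the reals agree on the
intersection of their discs of convergence. -/
lemma seriesAt_eq_seriesAt [CompleteSpace E] (hR : 0 < R) {A : ℝ → ℕ → E}
    (hA : ∀ t ∈ Icc (-1 : ℝ) 1, ∀ n, ‖A t n‖ ≤ C * R ^ n) {S : ℝ → E}
    (hS : ∀ t ∈ Icc (-1 : ℝ) 1, ∀ s ∈ Icc (-1 : ℝ) 1, |s - t| * R < 1 →
      seriesAt (A t) t (s : ℂ) = S s)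
    {t₀ t₁ : ℝ} (h₀ : t₀ ∈ Icc (-1 : ℝ) 1) (h₁ : t₁ ∈ Icc (-1 : ℝ) 1) {z : ℂ}
    (hz₀ : ‖z - t₀‖ * R < 1) (hz₁ : ‖z - t₁‖ * R < 1) :
    seriesAt (A t₀) t₀ z = seriesAt (A t₁) t₁ z := by
  wlog hlt : t₀ < t₁ generalizing t₀ t₁
  · rcases (not_lt.mp hlt).lt_or_eq with h | h
    · exact (this h₁ h₀ hz₁ hz₀ h).symm
    · rw [h]
  set U : Set ℂ := Metric.ball (t₀ : ℂ) (1 / R) ∩ Metric.ball (t₁ : ℂ) (1 / R) with hU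
  have hmem : ∀ (w : ℂ) (t : ℝ), w ∈ Metric.ball (t : ℂ) (1 / R) ↔ ‖w - t‖ * R < 1 := by
    intro w t
    rw [mem_ball_iff_norm, lt_div_iff₀ hR]
  have hpre : IsPreconnected U :=
    ((convex_ball _ _).inter (convex_ball _ _)).isPreconnected
  have hdist : (t₁ - t₀) * R < 2 := by
    have e : ((t₁ - t₀ : ℝ) : ℂ) = (z - t₀) - (z - t₁) := by push_cast; ring
    have : t₁ - t₀ ≤ ‖z - t₀‖ + ‖z - t₁‖ := by
      calc t₁ - t₀ ≤ ‖((t₁ - t₀ : ℝ) : ℂ)‖ := by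
            rw [Complex.norm_real]; exact le_abs_self _
        _ ≤ _ := by rw [e]; exact norm_sub_le _ _
    nlinarith
  have hreal : ∀ s t : ℝ, ‖(s : ℂ) - t‖ = |s - t| := fun s t => by
    rw [← Complex.ofReal_sub, Complex.norm_real, Real.norm_eq_abs]
  -- Discs with a common point have centres less than `2/R` apart, so the midpoint lies in both.
  -- Real points near it lie between the centres, hence in `[-1,1]`, where both series equal `S`.
  set m : ℝ := (t₀ + t₁) / 2 with hm
  have hm₀ : |m - t₀| * R < 1 := by
    rw [abs_of_pos (by rw [hm]; linarith), hm]; nlinarith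
  have hm₁ : |m - t₁| * R < 1 := by
    rw [abs_of_neg (by rw [hm]; linarith), hm]; nlinarith
  have hmU : (m : ℂ) ∈ U := ⟨(hmem _ _).mpr (by rwa [hreal]), (hmem _ _).mpr (by rwa [hreal])⟩
  refine AnalyticOnNhd.eqOn_of_preconnected_of_frequently_eq (𝕜 := ℂ) (U := U)
    (fun w hw => analyticAt_seriesAt hR (hA t₀ h₀) ((hmem _ _).mp hw.1))
    (fun w hw => analyticAt_seriesAt hR (hA t₁ h₁) ((hmem _ _).mp hw.2)) hpre hmU ?_
    ⟨(hmem _ _).mpr hz₀, (hmem _ _).mpr hz₁⟩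
  have htend : Tendsto (fun s : ℝ => (s : ℂ)) (𝓝[≠] m) (𝓝[≠] (m : ℂ)) := by
    refine tendsto_nhdsWithin_of_tendsto_nhds_of_eventually_within _
      (Complex.continuous_ofReal.continuousAt.tendsto.mono_left nhdsWithin_le_nhds) ?_
    filter_upwards [self_mem_nhdsWithin] with s hs
    simpa using hs
  refine htend.frequently (Eventually.frequently ?_)
  refine Filter.Eventually.filter_mono nhdsWithin_le_nhds ?_
  have c₀ : ∀ᶠ s in 𝓝 m, |s - t₀| * R < 1 :=
    (((continuous_id.sub continuous_const).abs.mul continuous_const).tendsto m).eventually_lt_const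
      hm₀
  have c₁ : ∀ᶠ s in 𝓝 m, |s - t₁| * R < 1 :=
    (((continuous_id.sub continuous_const).abs.mul continuous_const).tendsto m).eventually_lt_const
      hm₁
  have c₂ : ∀ᶠ s in 𝓝 m, s ∈ Ioo t₀ t₁ :=
    Ioo_mem_nhds (by rw [hm]; linarith) (by rw [hm]; linarith)
  filter_upwards [c₀, c₁, c₂] with s s₀ s₁ s₂
  have hs : s ∈ Icc (-1 : ℝ) 1 := ⟨h₀.1.trans s₂.1.le, s₂.2.le.trans h₁.2⟩
  rw [hS t₀ h₀ s hs s₀, hS t₁ h₁ s hs s₁]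

lemma exists_dist_eq_infDist (z : ℂ) : ∃ t ∈ Icc (-1 : ℝ) 1,
    ‖z - t‖ = Metric.infDist z ((fun t : ℝ => (t : ℂ)) '' Icc (-1) 1) := by
  obtain ⟨_, ⟨t, ht, rfl⟩, h⟩ := (isCompact_Icc.image Complex.continuous_ofReal :
    IsCompact ((fun t : ℝ => (t : ℂ)) '' Icc (-1) 1)).exists_infDist_eq_dist
      ((nonempty_Icc.mpr (by norm_num)).image _) z
  exact ⟨t, ht, by rw [h, dist_eq_norm]⟩

/-- Local expansions around the points of `[-1,1]` with radii of convergence at least `1 / R` glue to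
an analytic function on the `τ`-neighbourhood if `τ < 1 / R`. -/
theorem exists_analyticOnNhd_of_series [CompleteSpace E] (hR : 0 < R) {A : ℝ → ℕ → E}
    (hA : ∀ t ∈ Icc (-1 : ℝ) 1, ∀ n, ‖A t n‖ ≤ C * R ^ n) {S : ℝ → E}
    (hS : ∀ t ∈ Icc (-1 : ℝ) 1, ∀ s ∈ Icc (-1 : ℝ) 1, |s - t| * R < 1 →
      seriesAt (A t) t (s : ℂ) = S s) {τ : ℝ} (hτ : τ * R < 1) :
    ∃ F : ℂ → E, AnalyticOnNhd ℂ F (complexNhd τ) ∧ ∀ t ∈ Icc (-1 : ℝ) 1, F t = S t := by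
  choose T hT hTdist using exists_dist_eq_infDist
  -- `F` uses the expansion at a nearest point `T z`, which need not vary continuously; agreement on
  -- overlaps makes `F` locally equal to the one expansion at `T z₀`.
  refine ⟨fun z => seriesAt (A (T z)) (T z) z, fun z₀ hz₀ => ?_, fun t ht => ?_⟩
  · have h1 : ‖z₀ - T z₀‖ * R < 1 := by
      rw [hTdist]
      exact lt_of_le_of_lt (mul_le_mul_of_nonneg_right hz₀ hR.le) hτ
    refine (analyticAt_seriesAt hR (hA _ (hT z₀)) h1).congr ?_
    have e1 : ∀ᶠ z : ℂ in 𝓝 z₀, ‖z - T z₀‖ * R < 1 :=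
      ((by fun_prop : Continuous fun z : ℂ => ‖z - T z₀‖ * R).tendsto z₀).eventually_lt_const h1
    have e2 : ∀ᶠ z : ℂ in 𝓝 z₀,
        Metric.infDist z ((fun t : ℝ => (t : ℂ)) '' Icc (-1) 1) * R < 1 :=
      (((Metric.continuous_infDist_pt _).mul continuous_const).tendsto z₀).eventually_lt_const
        (by rw [hTdist] at h1; exact h1)
    filter_upwards [e1, e2] with z hz1 hz2
    exact seriesAt_eq_seriesAt hR hA hS (hT z₀) (hT z) hz1 (by rwa [hTdist])
  · refine hS _ (hT t) t ht ?_
    have : ‖(t : ℂ) - T t‖ = 0 := by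
      rw [hTdist]; exact Metric.infDist_zero_of_mem ⟨t, ht, rfl⟩
    rw [← Complex.ofReal_sub, Complex.norm_real, Real.norm_eq_abs] at this
    rw [this, zero_mul]; exact one_pos

end

/-- A family of functions on `[-1,1]`, depending continuously on a parameter, with uniformly bounded
local expansions extends analytically as a function with values in the continuous functions. -/
theorem exists_analyticOnNhd_continuousMap {X : Type*} [TopologicalSpace X] [CompactSpace X]
    {S : ℝ → X → ℝ} {a : ℝ → ℕ → X → ℝ} {R C : ℝ} (hR : 0 < R) (hC : 0 ≤ C)
    (ha : ∀ t ∈ Icc (-1 : ℝ) 1, ∀ n η, |a t n η| ≤ C * R ^ n)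
    (hsum : ∀ t₀ ∈ Icc (-1 : ℝ) 1, ∀ t ∈ Icc (-1 : ℝ) 1, |t - t₀| * R < 1 → ∀ η,
      HasSum (fun n => a t₀ n η * (t - t₀) ^ n) (S t η))
    (hcont : ∀ t ∈ Icc (-1 : ℝ) 1, Continuous (S t)) {τ : ℝ} (hτ : τ * R < 1) :
    ∃ F : ℂ → C(X, ℂ), AnalyticOnNhd ℂ F (complexNhd τ) ∧
      ∀ t ∈ Icc (-1 : ℝ) 1, ∀ η, F t η = (S t η : ℂ) := by
  have hA : ∀ t ∈ Icc (-1 : ℝ) 1, ∀ n, ∃ A : C(X, ℂ), ∀ η, A η = (a t n η : ℂ) := fun t ht n =>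
    ⟨⟨fun η => (a t n η : ℂ), Complex.continuous_ofReal.comp
      (continuous_coeff hR ht (ha t ht) (hsum t ht) hcont n)⟩, fun η => rfl⟩
  have hSc : ∀ t ∈ Icc (-1 : ℝ) 1, ∃ s : C(X, ℂ), ∀ η, s η = (S t η : ℂ) := fun t ht =>
    ⟨⟨fun η => (S t η : ℂ), Complex.continuous_ofReal.comp (hcont t ht)⟩, fun η => rfl⟩
  choose! A hA using hA
  choose! s hs using hSc
  have hAn : ∀ t ∈ Icc (-1 : ℝ) 1, ∀ n, ‖A t n‖ ≤ C * R ^ n := fun t ht n => by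
    rw [ContinuousMap.norm_le _ (by positivity)]
    intro η
    rw [hA t ht, Complex.norm_real]
    exact ha t ht n η
  obtain ⟨F, hF, hFs⟩ := exists_analyticOnNhd_of_series hR hAn (S := s) (fun t ht u hu htu => by
    ext η
    rw [hs u hu]
    have hsu := hasSum_seriesAt hR (hAn t ht) (z := (u : ℂ)) (t := t) (by
      rwa [← Complex.ofReal_sub, Complex.norm_real, Real.norm_eq_abs])
    have h1 := (ContinuousMap.evalCLM ℂ η).hasSum hsu
    refine h1.unique ?_
    have h2 := Complex.hasSum_ofReal.mpr (hsum t ht u hu htu η)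
    convert h2 using 2 with n
    simp [hA t ht, mul_comm]) hτ
  exact ⟨F, hF, fun t ht η => by rw [hFs t ht, hs t ht]⟩

end StoMsFEM

/-! ### Expansion of the energy of variational solutions with respect to a parameter -/

namespace StoMsFEM

section

variable {H : Type*} [NormedAddCommGroup H] [InnerProductSpace ℝ H]

/-- The Lax–Milgram theorem on a closed subspace. -/
lemma exists_solution [CompleteSpace H] {V : Submodule ℝ H} (hV : IsClosed (V : Set H)) {B : H →L[ℝ] H →L[ℝ] ℝ}
    {α : ℝ} (hα : 0 < α) (hB : ∀ u, α * ‖u‖ ^ 2 ≤ B u u) (ℓ : H →L[ℝ] ℝ) :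
    ∃ v ∈ V, ∀ w ∈ V, B v w = ℓ w := by
  have : CompleteSpace V := hV.completeSpace_coe
  let B' : V →L[ℝ] V →L[ℝ] ℝ := B.bilinearComp V.subtypeL V.subtypeL
  have hco : IsCoercive B' := ⟨α, hα, fun u => by
    have := hB u
    simp only [B', ContinuousLinearMap.bilinearComp_apply, Submodule.subtypeL_apply]
    rw [mul_assoc, ← sq]
    exact this⟩
  let r : V := (InnerProductSpace.toDual ℝ V).symm (ℓ.comp V.subtypeL)
  refine ⟨(hco.continuousLinearEquivOfBilin.symm r : V), Submodule.coe_mem _, fun w hw => ?_⟩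
  have h1 := hco.continuousLinearEquivOfBilin_apply (hco.continuousLinearEquivOfBilin.symm r) ⟨w, hw⟩
  rw [ContinuousLinearEquiv.apply_symm_apply, InnerProductSpace.toDual_symm_apply] at h1
  exact h1.symm

/-- The coefficients of the expansion of the solution, given the solution operator `sol` of the
unperturbed problem. -/
noncomputable def solutionCoeff (sol : (H →L[ℝ] ℝ) → H) (B : ℕ → H →L[ℝ] H →L[ℝ] ℝ) (g₀ : H) :
    ℕ → H
  | 0 => g₀
  | n + 1 => sol (-∑ k : Fin (n + 1), B (n + 1 - k) (solutionCoeff sol B g₀ k))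
decreasing_by exact k.2

/-- The conditions are the coefficients of `s^n` in the weak equation for `∑ s^n g_n`; the boundary
datum is carried entirely by `g 0`. -/
lemma exists_solutionCoeff [CompleteSpace H] {V : Submodule ℝ H} (hV : IsClosed (V : Set H))
    {B : ℕ → H →L[ℝ] H →L[ℝ] ℝ} {α : ℝ} (hα : 0 < α) (hB : ∀ u, α * ‖u‖ ^ 2 ≤ B 0 u u) (P : H) :
    ∃ g : ℕ → H, g 0 - P ∈ V ∧ (∀ n, g (n + 1) ∈ V) ∧
      ∀ n, ∀ w ∈ V, ∑ k ∈ Finset.range (n + 1), B (n - k) (g k) w = 0 := by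
  choose sol hsolV hsol using exists_solution hV hα hB
  refine ⟨solutionCoeff sol B (P + sol (-B 0 P)), ?_, fun n => ?_, fun n w hw => ?_⟩
  · rw [solutionCoeff, add_sub_cancel_left]; exact hsolV _
  · rw [solutionCoeff]; exact hsolV _
  · cases n with
    | zero =>
      simp [solutionCoeff, hsol _ w hw]
    | succ n =>
      have h : solutionCoeff sol B (P + sol (-B 0 P)) (n + 1) = sol (-∑ k : Fin (n + 1),
          B (n + 1 - k) (solutionCoeff sol B (P + sol (-B 0 P)) k)) := by rw [solutionCoeff]
      rw [Finset.sum_range_succ, Nat.sub_self, h, hsol _ w hw, Finset.sum_range]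
      simp

variable {B : ℕ → H →L[ℝ] H →L[ℝ] ℝ} {α c : ℝ}

lemma sum_pow_mul_two_pow (c : ℝ) (n : ℕ) :
    ∑ k ∈ Finset.range n, c ^ (n - k) * (2 * c) ^ k = c ^ n * (2 ^ n - 1) := by
  have h : ∀ k ∈ Finset.range n, c ^ (n - k) * (2 * c) ^ k = c ^ n * 2 ^ k := by
    intro k hk
    have hk := (Finset.mem_range.mp hk).le
    rw [mul_pow]
    calc _ = (c ^ (n - k) * c ^ k) * 2 ^ k := by ring
      _ = _ := by rw [← pow_add, Nat.sub_add_cancel hk]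
  rw [Finset.sum_congr rfl h, ← Finset.mul_sum, geom_sum_eq (by norm_num)]
  norm_num

/-- Testing the `n`-th equation with `g n` gives `‖g_n‖ ≤ ∑_{k<n} c^(n-k) ‖g_k‖` in the energy norm,
and `(2c)^n` solves this recursion since `∑_{k<n} 2^k ≤ 2^n`. At `n = 0` the test function is `g 0 -
P`. -/
lemma sqrt_energy_solutionCoeff_le {V : Submodule ℝ H} (hc : 0 ≤ c)
    (hpos : ∀ u, 0 ≤ B 0 u u)
    (hbd : ∀ n u v, |B n u v| ≤ c ^ n * (√(B 0 u u) * √(B 0 v v)))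
    {P : H} {g : ℕ → H} (hg₀ : g 0 - P ∈ V) (hgV : ∀ n, g (n + 1) ∈ V)
    (hg : ∀ n, ∀ w ∈ V, ∑ k ∈ Finset.range (n + 1), B (n - k) (g k) w = 0) (n : ℕ) :
    √(B 0 (g n) (g n)) ≤ (2 * c) ^ n * √(B 0 P P) := by
  induction n using Nat.strong_induction_on with
  | _ n ih =>
  set N := √(B 0 (g n) (g n)) with hN
  have hN0 : 0 ≤ N := Real.sqrt_nonneg _
  have hNsq : N * N = B 0 (g n) (g n) := Real.mul_self_sqrt (hpos _)
  suffices h : N * N ≤ N * ((2 * c) ^ n * √(B 0 P P)) by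
    rcases hN0.eq_or_lt with h0 | h0
    · rw [← h0]; positivity
    · exact le_of_mul_le_mul_left h h0
  cases n with
  | zero =>
    have h1 := hg 0 _ hg₀
    simp only [zero_add, Finset.sum_range_one, Nat.sub_self, map_sub, sub_eq_zero] at h1
    rw [hNsq, h1, pow_zero, one_mul]
    simpa using (le_abs_self _).trans (hbd 0 (g 0) P)
  | succ n =>
    have h1 := hg (n + 1) _ (hgV n)
    rw [Finset.sum_range_succ, Nat.sub_self] at h1
    have h2 : N * N = -∑ k ∈ Finset.range (n + 1), B (n + 1 - k) (g k) (g (n + 1)) := by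
      rw [hNsq]; linarith
    rw [h2]
    refine (neg_le_abs _).trans ((Finset.abs_sum_le_sum_abs _ _).trans ?_)
    calc ∑ k ∈ Finset.range (n + 1), |B (n + 1 - k) (g k) (g (n + 1))|
        ≤ ∑ k ∈ Finset.range (n + 1), N * √(B 0 P P) * (c ^ (n + 1 - k) * (2 * c) ^ k) := by
          refine Finset.sum_le_sum fun k hk => (hbd _ _ _).trans ?_
          have := ih k (Finset.mem_range.mp hk)
          calc _ ≤ c ^ (n + 1 - k) * (((2 * c) ^ k * √(B 0 P P)) * N) := by gcongr
            _ = _ := by ring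
      _ = N * √(B 0 P P) * (c ^ (n + 1) * (2 ^ (n + 1) - 1)) := by
          rw [← Finset.mul_sum, sum_pow_mul_two_pow]
      _ ≤ N * √(B 0 P P) * (c ^ (n + 1) * 2 ^ (n + 1)) := by gcongr; linarith
      _ = _ := by ring

/-- The double series is dominated by a product of geometric series with ratios `2c|s|` and `c|s|`.
Summed by rows it gives the form `Bs` at the summed series; summed along antidiagonals it gives the
Cauchy coefficients. -/
lemma hasSum_bilin_series [CompleteSpace H] {g : ℕ → H} {M s : ℝ} (hc : 0 ≤ c) (hα : 0 < α)
    (hcoer : ∀ u, α * ‖u‖ ^ 2 ≤ B 0 u u)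
    (hbd : ∀ n u v, |B n u v| ≤ c ^ n * (√(B 0 u u) * √(B 0 v v)))
    (hg : ∀ n, √(B 0 (g n) (g n)) ≤ (2 * c) ^ n * M) (hs : |s| * (2 * c) < 1)
    {Bs : H →L[ℝ] H →L[ℝ] ℝ} (hBs : ∀ u v, HasSum (fun n => B n u v * s ^ n) (Bs u v)) :
    Summable (fun n => s ^ n • g n) ∧ ∀ w,
      HasSum (fun n => (∑ k ∈ Finset.range (n + 1), B (n - k) (g k) w) * s ^ n)
        (Bs (∑' n, s ^ n • g n) w) := by
  have hM : 0 ≤ M := by simpa using (Real.sqrt_nonneg _).trans (hg 0)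
  have hgeo : Summable fun n : ℕ => (|s| * (2 * c)) ^ n :=
    summable_geometric_of_lt_one (by positivity) hs
  have hgeo' : Summable fun n : ℕ => (|s| * c) ^ n :=
    summable_geometric_of_lt_one (by positivity) (by
      have := abs_nonneg s
      nlinarith [mul_nonneg this hc])
  have hnorm : ∀ n, ‖g n‖ ≤ (2 * c) ^ n * M / √α := by
    intro n
    rw [le_div_iff₀ (Real.sqrt_pos.mpr hα)]
    refine le_trans ?_ (hg n)
    refine Real.le_sqrt_of_sq_le ?_
    rw [mul_pow, Real.sq_sqrt hα.le, mul_comm]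
    exact hcoer _
  have hsum : Summable fun n => s ^ n • g n := by
    refine Summable.of_norm_bounded (hgeo.mul_right (M / √α)) fun n => ?_
    rw [norm_smul, norm_pow, Real.norm_eq_abs]
    calc _ ≤ |s| ^ n * ((2 * c) ^ n * M / √α) := by gcongr; exact hnorm n
      _ = _ := by rw [mul_pow]; ring
  refine ⟨hsum, fun w => ?_⟩
  let f : ℕ × ℕ → ℝ := fun p => B p.2 (g p.1) w * s ^ p.2 * s ^ p.1
  have hf : Summable f := by
    have h1 := (hgeo.mul_of_nonneg hgeo' (fun n => by positivity) fun n => by positivity).mul_right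
      (M * √(B 0 w w))
    refine Summable.of_norm_bounded h1 fun p => ?_
    simp only [f]
    rw [norm_mul, norm_mul, norm_pow, norm_pow, Real.norm_eq_abs, Real.norm_eq_abs]
    calc |B p.2 (g p.1) w| * |s| ^ p.2 * |s| ^ p.1
        ≤ c ^ p.2 * (((2 * c) ^ p.1 * M) * √(B 0 w w)) * |s| ^ p.2 * |s| ^ p.1 := by
          have := hg p.1
          gcongr
          refine (hbd _ _ _).trans ?_
          gcongr
      _ = _ := by simp only [mul_pow]; ring
  have h2 : HasSum (fun k => Bs (g k) w * s ^ k) (∑' p, f p) :=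
    hf.hasSum.prod_fiberwise fun k => (hBs (g k) w).mul_right (s ^ k)
  have h3 : HasSum (fun k => Bs (g k) w * s ^ k) (Bs (∑' n, s ^ n • g n) w) := by
    have := (Bs.flip w).hasSum hsum.hasSum
    simpa [mul_comm] using this
  rw [← h2.unique h3]
  have h4 := (Finset.HasAntidiagonal.sigmaAntidiagonalEquivProd (A := ℕ)).hasSum_iff.mpr hf.hasSum
  have h5 := h4.sigma fun n => hasSum_fintype _
  convert h5 using 2 with n
  rw [Finset.sum_mul, ← Finset.Nat.sum_antidiagonal_eq_sum_range_succ_mk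
    (fun p : ℕ × ℕ => B p.2 (g p.1) w * s ^ n), ← Finset.sum_coe_sort]
  refine Finset.sum_congr rfl fun p _ => ?_
  have hp := Finset.HasAntidiagonal.mem_antidiagonal.mp p.2
  simp only [f, Function.comp, Finset.HasAntidiagonal.sigmaAntidiagonalEquivProd_apply]
  rw [mul_assoc, ← pow_add, add_comm p.1.2, hp]

/-- Expansion of the energy product of the solutions of variational problems whose bilinear form
depends analytically on a parameter. -/
theorem exists_energy_expansion [CompleteSpace H] {V : Submodule ℝ H} (hV : IsClosed (V : Set H)) (hc : 0 ≤ c)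
    (hα : 0 < α) (hcoer : ∀ u, α * ‖u‖ ^ 2 ≤ B 0 u u)
    (hbd : ∀ n u v, |B n u v| ≤ c ^ n * (√(B 0 u u) * √(B 0 v v))) (P P' : H) :
    ∃ a : ℕ → ℝ, (∀ n, |a n| ≤ 2 * (√(B 0 P P) * √(B 0 P' P')) * (2 * c) ^ n) ∧
      ∀ (s : ℝ) (Bs : H →L[ℝ] H →L[ℝ] ℝ) (G G' : H), |s| * (2 * c) < 1 →
        (∀ u v, HasSum (fun n => B n u v * s ^ n) (Bs u v)) →
        (∀ u, α * ‖u‖ ^ 2 ≤ Bs u u) → G - P ∈ V → G' - P' ∈ V → (∀ w ∈ V, Bs G w = 0) →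
        HasSum (fun n => a n * s ^ n) (Bs G G') := by
  obtain ⟨g, hg₀, hgV, hg⟩ := exists_solutionCoeff hV hα hcoer P
  have hpos : ∀ u, 0 ≤ B 0 u u := fun u => le_trans (by positivity) (hcoer u)
  have hgn := sqrt_energy_solutionCoeff_le hc hpos hbd hg₀ hgV hg
  refine ⟨fun n => ∑ k ∈ Finset.range (n + 1), B (n - k) (g k) P', fun n => ?_, ?_⟩
  · refine (Finset.abs_sum_le_sum_abs _ _).trans ?_
    set p := √(B 0 P P)
    set p' := √(B 0 P' P')
    calc ∑ k ∈ Finset.range (n + 1), |B (n - k) (g k) P'|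
        ≤ ∑ k ∈ Finset.range (n + 1), p * p' * (c ^ (n - k) * (2 * c) ^ k) := by
          refine Finset.sum_le_sum fun k _ => (hbd _ _ _).trans ?_
          calc _ ≤ c ^ (n - k) * (((2 * c) ^ k * p) * p') := by
                have := hgn k
                gcongr
            _ = _ := by ring
      _ = p * p' * (c ^ n * (2 ^ n - 1) + (2 * c) ^ n) := by
          rw [← Finset.mul_sum, Finset.sum_range_succ, sum_pow_mul_two_pow, Nat.sub_self, pow_zero,
            one_mul]
      _ ≤ p * p' * (c ^ n * 2 ^ n + (2 * c) ^ n) := by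
          have : 0 ≤ p * p' := by positivity
          gcongr
          linarith
      _ = _ := by rw [mul_pow]; ring
  · intro s Bs G G' hs hBs hBcoer hG hG' hGV
    obtain ⟨hsum, hexp⟩ := hasSum_bilin_series hc hα hcoer hbd hgn hs hBs
    set G₁ := ∑' n, s ^ n • g n with hG₁
    have horth : ∀ w ∈ V, Bs G₁ w = 0 := by
      intro w hw
      refine (hexp w).unique ?_
      simp only [hg _ w hw, zero_mul]
      exact hasSum_zero
    have hmem : G₁ - P ∈ V := by
      rw [hG₁, hsum.tsum_eq_zero_add, pow_zero, one_smul, add_sub_right_comm]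
      refine V.add_mem hg₀ ?_
      have h1 : Summable fun n => s ^ (n + 1) • g (n + 1) := (summable_nat_add_iff 1).mpr hsum
      exact hV.mem_of_tendsto h1.hasSum (Filter.Eventually.of_forall fun t =>
        V.sum_mem fun n _ => V.smul_mem _ (hgV n))
    have hdiff : G - G₁ ∈ V := by
      have := V.sub_mem hG hmem
      rwa [sub_sub_sub_cancel_right] at this
    -- Both functions solve the same problem and differ by an element of `V`, so coercivity
    -- identifies them.
    have heq : G = G₁ := by
      have h1 : Bs (G - G₁) (G - G₁) = 0 := by
        rw [map_sub Bs G G₁, sub_apply, hGV _ hdiff, horth _ hdiff, sub_zero]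
      have h2 := hBcoer (G - G₁)
      rw [h1] at h2
      have h3 : ‖G - G₁‖ ^ 2 ≤ 0 := by
        by_contra hcon
        push Not at hcon
        nlinarith
      exact sub_eq_zero.mp (norm_eq_zero.mp (pow_eq_zero_iff two_ne_zero |>.mp
        (le_antisymm h3 (sq_nonneg _))))
    -- `G' - P'` lies in `V`, which `Bs G` annihilates: only one of the two solutions has to be
    -- expanded.
    have h4 : Bs G G' = Bs G₁ P' := by
      rw [← heq, ← sub_eq_zero, ← map_sub]
      exact hGV _ hG'
    rw [h4]
    exact hexp P'

end

end StoMsFEM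

/-! ### Weighted bilinear forms on `L²` -/

namespace StoMsFEM

open Filter Topology

section

variable {Ω F : Type*} [MeasurableSpace Ω] {μ : Measure Ω} [NormedAddCommGroup F]
  [InnerProductSpace ℝ F]

lemma integrable_mul_inner {a : Ω → ℝ} {C : ℝ} (ha : AEStronglyMeasurable a μ)
    (hC : ∀ᵐ x ∂μ, |a x| ≤ C) (u v : Lp F 2 μ) :
    Integrable (fun x => a x * ⟪u x, v x⟫) μ :=
  (L2.integrable_inner (𝕜 := ℝ) u v).bdd_mul ha hC

/-- A weighted Cauchy–Schwarz inequality. -/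
lemma integral_abs_mul_inner_le {a b : Ω → ℝ} {C : ℝ} (ha : AEStronglyMeasurable a μ)
    (hb : AEStronglyMeasurable b μ) (hab : ∀ᵐ x ∂μ, |a x| ≤ b x) (hbC : ∀ᵐ x ∂μ, |b x| ≤ C)
    (u v : Lp F 2 μ) :
    ∫ x, |a x * ⟪u x, v x⟫| ∂μ ≤
      √(∫ x, b x * ⟪u x, u x⟫ ∂μ) * √(∫ x, b x * ⟪v x, v x⟫ ∂μ) := by
  have haC : ∀ᵐ x ∂μ, |a x| ≤ C := by
    filter_upwards [hab, hbC] with x h1 h2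
    exact h1.trans ((le_abs_self _).trans h2)
  have hI := (integrable_mul_inner ha haC u v).abs
  have hu := integrable_mul_inner hb hbC u u
  have hv := integrable_mul_inner hb hbC v v
  set X := ∫ x, |a x * ⟪u x, v x⟫| ∂μ
  set A := ∫ x, b x * ⟪u x, u x⟫ ∂μ with hA
  set B := ∫ x, b x * ⟪v x, v x⟫ ∂μ with hB
  have hX : 0 ≤ X := integral_nonneg fun x => abs_nonneg _
  have hA0 : 0 ≤ A := by
    refine integral_nonneg_of_ae ?_
    filter_upwards [hab] with x hx
    exact mul_nonneg ((abs_nonneg _).trans hx) real_inner_self_nonneg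
  -- Pointwise this is the square `b (|t|‖u‖ - ‖v‖)² ≥ 0`; the discriminant then gives `X² ≤ A B`.
  have hquad : ∀ t : ℝ, 0 ≤ A * (t * t) + (-(2 * X)) * t + B := by
    intro t
    have h1 : ∫ x, 2 * t * |a x * ⟪u x, v x⟫| ∂μ ≤
        ∫ x, t * t * (b x * ⟪u x, u x⟫) + b x * ⟪v x, v x⟫ ∂μ := by
      refine integral_mono_ae (hI.const_mul _) ((hu.const_mul _).add hv) ?_
      filter_upwards [hab] with x hx
      have h2 : |⟪u x, v x⟫| ≤ ‖u x‖ * ‖v x‖ := abs_real_inner_le_norm _ _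
      have h3 : |a x * ⟪u x, v x⟫| ≤ b x * (‖u x‖ * ‖v x‖) := by
        rw [abs_mul]
        exact mul_le_mul hx h2 (abs_nonneg _) ((abs_nonneg _).trans hx)
      have hb0 : 0 ≤ b x := (abs_nonneg _).trans hx
      simp only [real_inner_self_eq_norm_sq]
      have h4 : 0 ≤ b x * (|t| * ‖u x‖ - ‖v x‖) ^ 2 := by positivity
      have h5 : 2 * t * |a x * ⟪u x, v x⟫| ≤ 2 * |t| * (b x * (‖u x‖ * ‖v x‖)) := by
        have := le_abs_self t
        gcongr
      rw [← abs_mul_abs_self t]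
      linarith
    rw [integral_const_mul, integral_add (hu.const_mul _) hv, integral_const_mul] at h1
    linarith
  have h := discrim_le_zero hquad
  rw [discrim] at h
  rw [← Real.sqrt_mul hA0]
  refine Real.le_sqrt_of_sq_le ?_
  nlinarith

/-- `B` is the bilinear form `(u, v) ↦ ∫ a u · v` on `L²`. -/
def IsWeightedForm (μ : Measure Ω) (a : Ω → ℝ) (B : Lp F 2 μ →L[ℝ] Lp F 2 μ →L[ℝ] ℝ) : Prop :=
  ∀ u v, B u v = ∫ x, a x * ⟪u x, v x⟫ ∂μ

lemma integral_const_mul_inner_self (C : ℝ) (u : Lp F 2 μ) :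
    ∫ x, C * ⟪u x, u x⟫ ∂μ = C * ‖u‖ ^ 2 := by
  rw [integral_const_mul, ← real_inner_self_eq_norm_sq, L2.inner_def]

lemma abs_integral_mul_inner_le {a : Ω → ℝ} {C : ℝ} (ha : AEStronglyMeasurable a μ) (hC0 : 0 ≤ C)
    (hC : ∀ᵐ x ∂μ, |a x| ≤ C) (u v : Lp F 2 μ) :
    |∫ x, a x * ⟪u x, v x⟫ ∂μ| ≤ C * ‖u‖ * ‖v‖ := by
  refine abs_integral_le_integral_abs.trans ((integral_abs_mul_inner_le ha
    (b := fun _ => C) aestronglyMeasurable_const hC (C := |C|) (by simp) u v).trans (le_of_eq ?_))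
  rw [integral_const_mul_inner_self, integral_const_mul_inner_self, Real.sqrt_mul hC0,
    Real.sqrt_mul hC0, Real.sqrt_sq (norm_nonneg _), Real.sqrt_sq (norm_nonneg _)]
  have := Real.mul_self_sqrt hC0
  linear_combination ‖u‖ * ‖v‖ * this

lemma exists_isWeightedForm {a : Ω → ℝ} {C : ℝ} (ha : AEStronglyMeasurable a μ)
    (hC : ∀ᵐ x ∂μ, |a x| ≤ C) :
    ∃ B : Lp F 2 μ →L[ℝ] Lp F 2 μ →L[ℝ] ℝ, IsWeightedForm μ a B := by
  have hint := integrable_mul_inner (F := F) ha hC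
  have hC' : ∀ᵐ x ∂μ, |a x| ≤ |C| := hC.mono fun x hx => hx.trans (le_abs_self C)
  let B₀ : Lp F 2 μ →ₗ[ℝ] Lp F 2 μ →ₗ[ℝ] ℝ :=
    LinearMap.mk₂ ℝ (fun u v => ∫ x, a x * ⟪u x, v x⟫ ∂μ)
      (fun u u' v => by
        rw [← integral_add (hint u v) (hint u' v)]
        refine integral_congr_ae ?_
        filter_upwards [Lp.coeFn_add u u'] with x hx
        rw [hx, Pi.add_apply, inner_add_left, mul_add])
      (fun r u v => by
        rw [smul_eq_mul, ← integral_const_mul]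
        refine integral_congr_ae ?_
        filter_upwards [Lp.coeFn_smul r u] with x hx
        rw [hx, Pi.smul_apply, real_inner_smul_left]
        ring)
      (fun u v v' => by
        rw [← integral_add (hint u v) (hint u v')]
        refine integral_congr_ae ?_
        filter_upwards [Lp.coeFn_add v v'] with x hx
        rw [hx, Pi.add_apply, inner_add_right, mul_add])
      (fun r u v => by
        rw [smul_eq_mul, ← integral_const_mul]
        refine integral_congr_ae ?_
        filter_upwards [Lp.coeFn_smul r v] with x hx
        rw [hx, Pi.smul_apply, real_inner_smul_right]
        ring)
  exact ⟨B₀.mkContinuous₂ |C| fun u v => abs_integral_mul_inner_le ha (abs_nonneg C) hC' u v,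
    fun u v => rfl⟩

namespace IsWeightedForm

variable {a : Ω → ℝ} {B : Lp F 2 μ →L[ℝ] Lp F 2 μ →L[ℝ] ℝ}

lemma symm (hB : IsWeightedForm μ a B) (u v : Lp F 2 μ) : B u v = B v u := by
  rw [hB, hB]
  simp only [real_inner_comm]

lemma le_apply_self {α C : ℝ} (hB : IsWeightedForm μ a B) (ha : AEStronglyMeasurable a μ)
    (hC : ∀ᵐ x ∂μ, |a x| ≤ C) (hα : ∀ᵐ x ∂μ, α ≤ a x) (u : Lp F 2 μ) :
    α * ‖u‖ ^ 2 ≤ B u u := by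
  rw [hB, ← integral_const_mul_inner_self]
  refine integral_mono_ae ((L2.integrable_inner (𝕜 := ℝ) u u).const_mul α)
    (integrable_mul_inner ha hC u u) ?_
  filter_upwards [hα] with x hx
  exact mul_le_mul_of_nonneg_right hx real_inner_self_nonneg

lemma apply_self_le {β C : ℝ} (hB : IsWeightedForm μ a B) (ha : AEStronglyMeasurable a μ)
    (hC : ∀ᵐ x ∂μ, |a x| ≤ C) (hβ : ∀ᵐ x ∂μ, a x ≤ β) (u : Lp F 2 μ) :
    B u u ≤ β * ‖u‖ ^ 2 := by
  rw [hB, ← integral_const_mul_inner_self]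
  refine integral_mono_ae (integrable_mul_inner ha hC u u)
    ((L2.integrable_inner (𝕜 := ℝ) u u).const_mul β) ?_
  filter_upwards [hβ] with x hx
  exact mul_le_mul_of_nonneg_right hx real_inner_self_nonneg

/-- Measuring `a'` relative to the weight `a` gives the factor `q` in the energy norm itself, so the
ellipticity ratio never enters the radius of convergence. -/
lemma abs_apply_le {a' : Ω → ℝ} {B' : Lp F 2 μ →L[ℝ] Lp F 2 μ →L[ℝ] ℝ} {C q : ℝ}
    (hB : IsWeightedForm μ a B) (hB' : IsWeightedForm μ a' B') (ha : AEStronglyMeasurable a μ)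
    (ha' : AEStronglyMeasurable a' μ) (hq : 0 ≤ q) (h : ∀ᵐ x ∂μ, |a' x| ≤ q * a x)
    (hC : ∀ᵐ x ∂μ, |a x| ≤ C) (u v : Lp F 2 μ) :
    |B' u v| ≤ q * (√(B u u) * √(B v v)) := by
  rw [hB']
  refine abs_integral_le_integral_abs.trans ((integral_abs_mul_inner_le ha'
    (b := fun x => q * a x) (ha.const_mul q) h (C := q * C) ?_ u v).trans (le_of_eq ?_))
  · filter_upwards [hC] with x hx
    rw [abs_mul, abs_of_nonneg hq]
    gcongr
  · simp only [mul_assoc, integral_const_mul, ← hB u u, ← hB v v]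
    rw [Real.sqrt_mul hq, Real.sqrt_mul hq]
    have := Real.mul_self_sqrt hq
    linear_combination √(B u u) * √(B v v) * this

lemma hasSum {b : ℕ → Ω → ℝ} {D : ℕ → Lp F 2 μ →L[ℝ] Lp F 2 μ →L[ℝ] ℝ} {C c s : ℝ}
    (hB : IsWeightedForm μ a B) (hD : ∀ n, IsWeightedForm μ (b n) (D n)) (hc : 0 ≤ c)
    (hb : ∀ n, AEStronglyMeasurable (b n) μ) (hbC : ∀ n, ∀ᵐ x ∂μ, |b n x| ≤ C * c ^ n)
    (hs : |s| * c < 1) (hsum : ∀ᵐ x ∂μ, HasSum (fun n => b n x * s ^ n) (a x)) (u v : Lp F 2 μ) :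
    HasSum (fun n => D n u v * s ^ n) (B u v) := by
  have hI := (L2.integrable_inner (𝕜 := ℝ) u v)
  have hgeo : Summable fun n : ℕ => (|s| * c) ^ n :=
    summable_geometric_of_lt_one (by positivity) hs
  rw [hB]
  simp only [hD _ u v, ← integral_mul_const]
  refine hasSum_integral_of_dominated_convergence
    (fun n x => (|s| * c) ^ n * (C * |⟪u x, v x⟫|))
    (fun n => ((hb n).mul hI.aestronglyMeasurable).mul_const _) (fun n => ?_)
    (Eventually.of_forall fun x => hgeo.mul_right _) ?_ ?_
  · filter_upwards [hbC n] with x hx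
    rw [norm_mul, norm_mul, norm_pow, Real.norm_eq_abs, Real.norm_eq_abs, Real.norm_eq_abs]
    calc |b n x| * |⟪u x, v x⟫| * |s| ^ n ≤ C * c ^ n * |⟪u x, v x⟫| * |s| ^ n := by gcongr
      _ = _ := by rw [mul_pow]; ring
  · simp only [tsum_mul_right]
    exact (hI.abs.const_mul C).const_mul _
  · filter_upwards [hsum] with x hx
    have h := hx.mul_right ⟪u x, v x⟫
    simpa only [mul_right_comm] using h

end IsWeightedForm

end

/-! ### Taylor expansion of the coefficient -/

/-- Convergence of the Taylor series on `[-1,1]` under geometric bounds on the derivatives. -/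
lemma hasSum_taylor {f : ℝ → ℝ} (hf : ContDiffOn ℝ ∞ f (Icc (-1) 1)) {c M : ℝ} (hc : 0 ≤ c)
    (hb : ∀ n : ℕ, ∀ t ∈ Icc (-1 : ℝ) 1,
      |iteratedDerivWithin n f (Icc (-1) 1) t| ≤ c ^ n * (n.factorial : ℝ) * M)
    {t₀ t : ℝ} (ht₀ : t₀ ∈ Icc (-1 : ℝ) 1) (ht : t ∈ Icc (-1 : ℝ) 1) (h : |t - t₀| * c < 1) :
    HasSum (fun n : ℕ => iteratedDerivWithin n f (Icc (-1) 1) t₀ / (n.factorial : ℝ) *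
      (t - t₀) ^ n) (f t) := by
  set x := |t - t₀| * c
  have hx0 : 0 ≤ x := by positivity
  have hfac : ∀ n : ℕ, (0 : ℝ) < n.factorial := fun n => by exact_mod_cast n.factorial_pos
  have hM : 0 ≤ M := by simpa using (abs_nonneg _).trans (hb 0 t ht)
  have hsum : Summable fun n : ℕ => iteratedDerivWithin n f (Icc (-1) 1) t₀ / (n.factorial : ℝ) *
      (t - t₀) ^ n := by
    refine Summable.of_norm_bounded ((summable_geometric_of_lt_one hx0 h).mul_right M) fun n => ?_
    rw [norm_mul, norm_div, norm_pow, Real.norm_eq_abs, Real.norm_eq_abs, Real.norm_eq_abs,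
      abs_of_pos (hfac n)]
    have h1 : |iteratedDerivWithin n f (Icc (-1) 1) t₀| / n.factorial ≤ c ^ n * M := by
      rw [div_le_iff₀ (hfac n)]
      refine (hb n t₀ ht₀).trans (le_of_eq (by ring))
    calc _ ≤ c ^ n * M * |t - t₀| ^ n := by gcongr
      _ = _ := by rw [mul_pow]; ring
  rw [hsum.hasSum_iff_tendsto_nat]
  have hbound : ∀ n : ℕ, |f t - ∑ i ∈ Finset.range (n + 1),
      iteratedDerivWithin i f (Icc (-1) 1) t₀ / (i.factorial : ℝ) * (t - t₀) ^ i| ≤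
        M * ((n + 1 : ℕ) * x ^ (n + 1)) := by
    intro n
    -- The remainder is controlled by varying the centre `y` of the Taylor polynomial at fixed `t`:
    -- at `y = t` it equals `f t`, and its derivative is a single term. This treats both sides of
    -- `t₀` at once, at the cost of a harmless factor `n + 1`.
    have hder : ∀ y ∈ uIcc t₀ t, HasDerivWithinAt
        (fun y => taylorWithinEval f n (Icc (-1) 1) y t)
        (((n.factorial : ℝ)⁻¹ * (t - y) ^ n) • iteratedDerivWithin (n + 1) f (Icc (-1) 1) y)
        (uIcc t₀ t) y := by
      intro y hy
      refine (hasDerivWithinAt_taylorWithinEval_at_Icc t (by norm_num)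
        (uIcc_subset_Icc ht₀ ht hy) (hf.of_le (by exact_mod_cast le_top)) ?_).mono
          (uIcc_subset_Icc ht₀ ht)
      exact hf.differentiableOn_iteratedDerivWithin
        (by exact_mod_cast WithTop.coe_lt_top _) (uniqueDiffOn_Icc (by norm_num))
    have h1 := Convex.norm_image_sub_le_of_norm_hasDerivWithin_le hder
      (C := |t - t₀| ^ n * (c ^ (n + 1) * (n + 1 : ℕ) * M)) (fun y hy => ?_) (convex_uIcc _ _)
      left_mem_uIcc right_mem_uIcc
    · rw [taylorWithinEval_self, taylor_within_apply, Real.norm_eq_abs, Real.norm_eq_abs] at h1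
      calc _ = |f t - ∑ k ∈ Finset.range (n + 1), ((k.factorial : ℝ)⁻¹ * (t - t₀) ^ k) •
            iteratedDerivWithin k f (Icc (-1) 1) t₀| := by
            congr 2
            refine Finset.sum_congr rfl fun i _ => ?_
            rw [smul_eq_mul]; ring
        _ ≤ _ := h1
        _ = _ := by simp only [x, mul_pow]; ring
    · rw [norm_smul, norm_mul, norm_inv, norm_pow, Real.norm_eq_abs, Real.norm_eq_abs,
        Real.norm_eq_abs, abs_of_pos (hfac n)]
      have h2 : |t - y| ≤ |t - t₀| := abs_sub_right_of_mem_uIcc hy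
      have h3 := hb (n + 1) y (uIcc_subset_Icc ht₀ ht hy)
      calc _ ≤ (n.factorial : ℝ)⁻¹ * |t - t₀| ^ n *
            (c ^ (n + 1) * ((n + 1).factorial : ℝ) * M) := by gcongr
        _ = _ := by
            rw [Nat.factorial_succ]
            have := (hfac n).ne'
            push_cast
            field_simp
  rw [← tendsto_add_atTop_iff_nat 1, tendsto_iff_norm_sub_tendsto_zero]
  refine squeeze_zero (fun n => norm_nonneg _) (fun n => ?_) (?_ : Tendsto
    (fun n : ℕ => M * ((n + 1 : ℕ) * x ^ (n + 1))) atTop (𝓝 0))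
  · rw [norm_sub_rev]; exact hbound n
  · have := (tendsto_self_mul_const_pow_of_lt_one hx0 h).const_mul M
    rw [mul_zero] at this
    exact this.comp (tendsto_add_atTop_nat 1)

/-! ### Null sets and measurability in the parameter -/

section

variable {Ω : Type*} [MeasurableSpace Ω] {μ : Measure Ω} {f : Ω → ℝ → ℝ}

/-- Bounds that hold almost everywhere at each parameter hold almost everywhere at all
parameters. -/
lemma ae_forall_mem_Icc (hf : ∀ᵐ x ∂μ, ContDiffOn ℝ ∞ (f x) (Icc (-1) 1)) {κmin κmax : ℝ}
    (hbd : ∀ t ∈ Icc (-1 : ℝ) 1, ∀ᵐ x ∂μ, κmin ≤ f x t ∧ f x t ≤ κmax) :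
    ∀ᵐ x ∂μ, ∀ t ∈ Icc (-1 : ℝ) 1, f x t ∈ Icc κmin κmax := by
  have : Nonempty (Icc (-1 : ℝ) 1) := ⟨⟨0, by norm_num⟩⟩
  -- A countable dense set of parameters needs only one null set; continuity in `t` extends the
  -- closed condition to all of them.
  have h1 : ∀ᵐ x ∂μ, ∀ m : ℕ, f x (denseSeq (Icc (-1 : ℝ) 1) m) ∈ Icc κmin κmax :=
    ae_all_iff.mpr fun m => hbd _ (denseSeq (Icc (-1 : ℝ) 1) m).2
  filter_upwards [hf, h1] with x hfx hx t ht
  have hc : Continuous fun t : Icc (-1 : ℝ) 1 => f x t :=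
    continuousOn_iff_continuous_domRestrict.mp hfx.continuousOn
  exact (denseRange_denseSeq (Icc (-1 : ℝ) 1)).induction_on
    (p := fun t => f x t ∈ Icc κmin κmax) (⟨t, ht⟩ : Icc (-1 : ℝ) 1)
    (isClosed_Icc.preimage hc) hx

/-- Bounds on the derivatives that hold almost everywhere at each parameter hold almost everywhere
at all parameters. -/
lemma ae_forall_abs_iteratedDerivWithin_le
    (hf : ∀ᵐ x ∂μ, ContDiffOn ℝ ∞ (f x) (Icc (-1) 1)) {c κmin κmax : ℝ} (hmin : 0 < κmin)
    (hbd : ∀ t ∈ Icc (-1 : ℝ) 1, ∀ᵐ x ∂μ, κmin ≤ f x t ∧ f x t ≤ κmax)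
    (hgrowth : ∀ n : ℕ, ∀ t ∈ Icc (-1 : ℝ) 1, ∀ᵐ x ∂μ,
      |iteratedDerivWithin n (f x) (Icc (-1) 1) t / f x t| ≤ c ^ n * (n.factorial : ℝ)) :
    ∀ᵐ x ∂μ, ∀ n : ℕ, ∀ t ∈ Icc (-1 : ℝ) 1,
      |iteratedDerivWithin n (f x) (Icc (-1) 1) t| ≤ c ^ n * (n.factorial : ℝ) * f x t := by
  have : Nonempty (Icc (-1 : ℝ) 1) := ⟨⟨0, by norm_num⟩⟩
  have h1 : ∀ᵐ x ∂μ, ∀ m : ℕ, κmin ≤ f x (denseSeq (Icc (-1 : ℝ) 1) m) :=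
    ae_all_iff.mpr fun m => (hbd _ (denseSeq (Icc (-1 : ℝ) 1) m).2).mono fun x hx => hx.1
  have h2 : ∀ᵐ x ∂μ, ∀ n m : ℕ,
      |iteratedDerivWithin n (f x) (Icc (-1) 1) (denseSeq (Icc (-1 : ℝ) 1) m) /
        f x (denseSeq (Icc (-1 : ℝ) 1) m)| ≤ c ^ n * (n.factorial : ℝ) :=
    ae_all_iff.mpr fun n => ae_all_iff.mpr fun m => hgrowth n _ (denseSeq (Icc (-1 : ℝ) 1) m).2
  filter_upwards [hf, h1, h2] with x hfx hx1 hx2 n t ht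
  have c1 : Continuous fun t : Icc (-1 : ℝ) 1 => |iteratedDerivWithin n (f x) (Icc (-1) 1) t| :=
    (continuousOn_iff_continuous_domRestrict.mp (hfx.continuousOn_iteratedDerivWithin (m := n)
      (by exact_mod_cast le_top) (uniqueDiffOn_Icc (by norm_num)))).abs
  have c2 : Continuous fun t : Icc (-1 : ℝ) 1 => c ^ n * (n.factorial : ℝ) * f x t :=
    continuous_const.mul (continuousOn_iff_continuous_domRestrict.mp hfx.continuousOn)
  refine (denseRange_denseSeq (Icc (-1 : ℝ) 1)).induction_on
    (p := fun t => |iteratedDerivWithin n (f x) (Icc (-1) 1) t| ≤ c ^ n * (n.factorial : ℝ) * f x t)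
    (⟨t, ht⟩ : Icc (-1 : ℝ) 1) (isClosed_le c1 c2) fun m => ?_
  have h3 := hx2 n m
  have h4 : 0 < f x (denseSeq (Icc (-1 : ℝ) 1) m) := hmin.trans_le (hx1 m)
  rwa [abs_div, abs_of_pos h4, div_le_iff₀ h4] at h3

/-- Each derivative is an almost everywhere limit of difference quotients of the previous one along
a fixed sequence in the interval. -/
lemma aestronglyMeasurable_iteratedDerivWithin
    (hf : ∀ᵐ x ∂μ, ContDiffOn ℝ ∞ (f x) (Icc (-1) 1))
    (hmeas : ∀ t ∈ Icc (-1 : ℝ) 1, AEStronglyMeasurable (fun x => f x t) μ) (n : ℕ) :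
    ∀ t ∈ Icc (-1 : ℝ) 1,
      AEStronglyMeasurable (fun x => iteratedDerivWithin n (f x) (Icc (-1) 1) t) μ := by
  induction n with
  | zero => simpa using hmeas
  | succ n ih =>
    intro t ht
    obtain ⟨y, hy, hyt⟩ : ∃ y : ℕ → ℝ, (∀ j, y j ∈ Icc (-1 : ℝ) 1 \ {t}) ∧
        Tendsto y atTop (𝓝 t) := by
      have hlim := tendsto_one_div_add_atTop_nhds_zero_nat (𝕜 := ℝ)
      have hpos : ∀ j : ℕ, (0 : ℝ) < 1 / ((j : ℝ) + 1) := fun j => by positivity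
      have hle : ∀ j : ℕ, 1 / ((j : ℝ) + 1) ≤ 1 := fun j => by
        rw [div_le_one (by positivity)]; linarith [j.cast_nonneg (α := ℝ)]
      rcases le_total t 0 with h | h
      · refine ⟨fun j => t + 1 / ((j : ℝ) + 1), fun j => ⟨⟨?_, ?_⟩, ?_⟩, by
          simpa using hlim.const_add t⟩
        · linarith [ht.1, hpos j]
        · linarith [hle j]
        · simpa using (hpos j).ne'
      · refine ⟨fun j => t - 1 / ((j : ℝ) + 1), fun j => ⟨⟨?_, ?_⟩, ?_⟩, by
          simpa using hlim.const_sub t⟩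
        · linarith [hle j]
        · linarith [ht.2, hpos j]
        · simpa using (hpos j).ne'
    refine aestronglyMeasurable_of_tendsto_ae atTop
      (f := fun j x => slope (iteratedDerivWithin n (f x) (Icc (-1) 1)) t (y j)) (fun j => ?_) ?_
    · simp only [slope, vsub_eq_sub, smul_eq_mul]
      exact ((ih _ (hy j).1).sub (ih t ht)).const_mul _
    · filter_upwards [hf] with x hx
      rw [iteratedDerivWithin_succ]
      have hd := (hx.differentiableOn_iteratedDerivWithin (m := n)
        (by exact_mod_cast WithTop.coe_lt_top _) (uniqueDiffOn_Icc (by norm_num)) t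
          ht).hasDerivWithinAt
      rw [hasDerivWithinAt_iff_tendsto_slope] at hd
      refine hd.comp (tendsto_nhdsWithin_iff.mpr ⟨hyt, Eventually.of_forall hy⟩)

end

end StoMsFEM

/-! ### Regularity of the stiffness entries -/

namespace StoMsFEM

open Filter Topology

section

variable {Ω F : Type*} [MeasurableSpace Ω] {μ : Measure Ω} [NormedAddCommGroup F]
  [InnerProductSpace ℝ F] {a a' : Ω → ℝ} {B B' : Lp F 2 μ →L[ℝ] Lp F 2 μ →L[ℝ] ℝ}
  {κmin κmax : ℝ} {V : Submodule ℝ (Lp F 2 μ)}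

namespace IsWeightedForm

/-- Testing with `G - P` gives `B G G = B G P`; coercivity and boundedness do the rest. -/
lemma norm_solution_le (hB : IsWeightedForm μ a B) (ha : AEStronglyMeasurable a μ)
    (hmin : 0 < κmin) (hmax : 0 < κmax) (hbd : ∀ᵐ x ∂μ, κmin ≤ a x ∧ a x ≤ κmax)
    {P G : Lp F 2 μ} (hG : G - P ∈ V) (hGV : ∀ w ∈ V, B G w = 0) :
    ‖G‖ ≤ κmax / κmin * ‖P‖ := by
  have hC : ∀ᵐ x ∂μ, |a x| ≤ κmax := hbd.mono fun x hx => by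
    rw [abs_of_pos (hmin.trans_le hx.1)]; exact hx.2
  have h1 := hB.le_apply_self ha hC (hbd.mono fun x hx => hx.1) G
  have h2 : B G G = B G P := by
    rw [← sub_eq_zero, ← map_sub]; exact hGV _ hG
  have h3 := abs_integral_mul_inner_le ha hmax.le hC G P
  rw [← hB G P, ← h2] at h3
  have h4 : κmin * ‖G‖ ^ 2 ≤ κmax * ‖G‖ * ‖P‖ := h1.trans ((le_abs_self _).trans h3)
  rw [div_mul_eq_mul_div, le_div_iff₀ hmin]
  rcases (norm_nonneg G).eq_or_lt with h0 | h0
  · rw [← h0, zero_mul]; positivity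
  · refine le_of_mul_le_mul_left ?_ h0
    linarith

/-- Lipschitz dependence of the energy product of two solutions on the coefficient. -/
lemma abs_energy_sub_le (hB : IsWeightedForm μ a B) (hB' : IsWeightedForm μ a' B')
    (ha : AEStronglyMeasurable a μ) (ha' : AEStronglyMeasurable a' μ) (hmin : 0 < κmin)
    (hmax : 0 < κmax) (hbd : ∀ᵐ x ∂μ, κmin ≤ a x ∧ a x ≤ κmax)
    (hbd' : ∀ᵐ x ∂μ, κmin ≤ a' x ∧ a' x ≤ κmax) {δ : ℝ} (hδ : 0 ≤ δ)
    (haa' : ∀ᵐ x ∂μ, |a' x - a x| ≤ δ) {P Q G H G' H' : Lp F 2 μ}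
    (hG : G - P ∈ V) (hH : H - Q ∈ V) (hG' : G' - P ∈ V) (hH' : H' - Q ∈ V)
    (hGV' : ∀ w ∈ V, B' G' w = 0) (hHV : ∀ w ∈ V, B H w = 0) :
    |B' G' H' - B G H| ≤ δ * ((κmax / κmin * ‖P‖) * (κmax / κmin * ‖Q‖)) := by
  have hC : ∀ᵐ x ∂μ, |a x| ≤ κmax := hbd.mono fun x hx => by
    rw [abs_of_pos (hmin.trans_le hx.1)]; exact hx.2
  have hC' : ∀ᵐ x ∂μ, |a' x| ≤ κmax := hbd'.mono fun x hx => by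
    rw [abs_of_pos (hmin.trans_le hx.1)]; exact hx.2
  -- Orthogonality moves both energies to the same pair `G'`, `H`, so the solutions need not be
  -- compared: the difference is an integral of `a' - a`.
  have h1 : B' G' H' = B' G' H := by
    rw [← sub_eq_zero, ← map_sub]
    refine hGV' _ ?_
    have := V.sub_mem hH' hH
    rwa [sub_sub_sub_cancel_right] at this
  have h2 : B G H = B G' H := by
    rw [hB.symm G, hB.symm G', ← sub_eq_zero, ← map_sub]
    refine hHV _ ?_
    have := V.sub_mem hG hG'
    rwa [sub_sub_sub_cancel_right] at this
  have h3 : B' G' H' - B G H = ∫ x, (a' x - a x) * ⟪G' x, H x⟫ ∂μ := by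
    rw [h1, h2, hB', hB, ← integral_sub (integrable_mul_inner ha' hC' _ _)
      (integrable_mul_inner ha hC _ _)]
    simp only [sub_mul]
  rw [h3]
  refine (abs_integral_mul_inner_le (ha'.sub ha) hδ haa' G' H).trans ?_
  have n1 := hB'.norm_solution_le ha' hmin hmax hbd' hG' hGV'
  have n2 := hB.norm_solution_le ha hmin hmax hbd hH hHV
  rw [mul_assoc]
  gcongr

end IsWeightedForm

end

/-! ### Coefficients and functions on the parameter cube -/

section

variable {Ω : Type*} [MeasurableSpace Ω] {K : ℕ}

/-- Uniformly elliptic coefficients with geometrically growing partial derivatives in the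
parameters. -/
structure IsAnalyticCoefficient (μ : Measure Ω) (κ : Ω → (Fin K → ℝ) → ℝ) (κmin κmax : ℝ)
    (c : Fin K → ℝ) : Prop where
  min_pos : 0 < κmin
  max_pos : 0 < κmax
  meas : ∀ ξ ∈ paramCube K, AEStronglyMeasurable (fun x => κ x ξ) μ
  bound : ∀ ξ ∈ paramCube K, ∀ᵐ x ∂μ, κmin ≤ κ x ξ ∧ κ x ξ ≤ κmax
  smooth : ∀ᵐ x ∂μ, ContDiffOn ℝ ∞ (κ x) (paramCube K)
  rate_pos : ∀ k, 0 < c k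
  growth : ∀ k, ∀ n : ℕ, ∀ ξ ∈ paramCube K, ∀ᵐ x ∂μ,
    |partialDeriv k n (κ x) ξ / κ x ξ| ≤ c k ^ n * (n.factorial : ℝ)

lemma update_mem_paramCube {ξ : Fin K → ℝ} (hξ : ξ ∈ paramCube K) (k : Fin K) {t : ℝ}
    (ht : t ∈ Icc (-1 : ℝ) 1) : Function.update ξ k t ∈ paramCube K := by
  intro j
  by_cases hj : j = k
  · subst hj; simpa using ht
  · simpa [hj] using hξ j

namespace IsAnalyticCoefficient

variable {μ : Measure Ω} {κ : Ω → (Fin K → ℝ) → ℝ} {κmin κmax : ℝ} {c : Fin K → ℝ}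
  {ξ : Fin K → ℝ}

lemma abs_le (h : IsAnalyticCoefficient μ κ κmin κmax c) (hξ : ξ ∈ paramCube K) :
    ∀ᵐ x ∂μ, |κ x ξ| ≤ κmax :=
  (h.bound ξ hξ).mono fun x hx => by
    rw [abs_of_pos (h.min_pos.trans_le hx.1)]; exact hx.2

lemma contDiffOn_line (h : IsAnalyticCoefficient μ κ κmin κmax c) (hξ : ξ ∈ paramCube K)
    (k : Fin K) :
    ∀ᵐ x ∂μ, ContDiffOn ℝ ∞ (fun t => κ x (Function.update ξ k t)) (Icc (-1) 1) :=
  h.smooth.mono fun _ hx => hx.comp (contDiff_update ∞ ξ k).contDiffOn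
    fun _ ht => update_mem_paramCube hξ k ht

lemma mem_Icc_line (h : IsAnalyticCoefficient μ κ κmin κmax c) (hξ : ξ ∈ paramCube K)
    (k : Fin K) : ∀ᵐ x ∂μ, ∀ t ∈ Icc (-1 : ℝ) 1, κ x (Function.update ξ k t) ∈ Icc κmin κmax :=
  ae_forall_mem_Icc (f := fun x t => κ x (Function.update ξ k t)) (h.contDiffOn_line hξ k)
    fun _ ht => h.bound _ (update_mem_paramCube hξ k ht)

lemma growth_line (h : IsAnalyticCoefficient μ κ κmin κmax c) (hξ : ξ ∈ paramCube K)
    (k : Fin K) : ∀ᵐ x ∂μ, ∀ n : ℕ, ∀ t ∈ Icc (-1 : ℝ) 1,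
      |iteratedDerivWithin n (fun t => κ x (Function.update ξ k t)) (Icc (-1) 1) t| ≤
        c k ^ n * (n.factorial : ℝ) * κ x (Function.update ξ k t) := by
  refine ae_forall_abs_iteratedDerivWithin_le (f := fun x t => κ x (Function.update ξ k t))
    (h.contDiffOn_line hξ k) h.min_pos
    (fun _ ht => h.bound _ (update_mem_paramCube hξ k ht)) fun n t ht => ?_
  have := h.growth k n _ (update_mem_paramCube hξ k ht)
  simpa only [partialDeriv, Function.update_idem, Function.update_self] using this

lemma abs_update_sub_le (h : IsAnalyticCoefficient μ κ κmin κmax c) (hξ : ξ ∈ paramCube K)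
    (k : Fin K) {t : ℝ} (ht : t ∈ Icc (-1 : ℝ) 1) :
    ∀ᵐ x ∂μ, |κ x (Function.update ξ k t) - κ x ξ| ≤ c k * κmax * |t - ξ k| := by
  filter_upwards [h.contDiffOn_line hξ k, h.mem_Icc_line hξ k, h.growth_line hξ k]
    with x h1 h2 h3
  have hd : DifferentiableOn ℝ (fun t => κ x (Function.update ξ k t)) (Icc (-1) 1) :=
    h1.differentiableOn (by simp)
  have := Convex.norm_image_sub_le_of_norm_hasDerivWithin_le (C := c k * κmax)
    (fun y hy => (hd y hy).hasDerivWithinAt) (fun y hy => ?_) (convex_Icc (-1 : ℝ) 1) (hξ k) ht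
  · simpa using this
  · have h4 := h3 1 y hy
    rw [iteratedDerivWithin_one, pow_one, Nat.factorial_one, Nat.cast_one, mul_one] at h4
    exact h4.trans (mul_le_mul_of_nonneg_left (h2 y hy).2 (h.rate_pos k).le)

end IsAnalyticCoefficient

/-- Coordinatewise Lipschitz functions on the cube are continuous. -/
lemma continuousOn_paramCube {S : (Fin K → ℝ) → ℝ} {M : Fin K → ℝ}
    (hS : ∀ ξ ∈ paramCube K, ∀ k, ∀ t ∈ Icc (-1 : ℝ) 1,
      |S (Function.update ξ k t) - S ξ| ≤ M k * |t - ξ k|) : ContinuousOn S (paramCube K) := by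
  classical
  -- The coordinates of `ξ` are replaced by those of `ξ'` one after another; the intermediate points
  -- stay in the cube.
  have key : ∀ ξ ∈ paramCube K, ∀ ξ' ∈ paramCube K, ∀ s : Finset (Fin K),
      |S (s.piecewise ξ' ξ) - S ξ| ≤ ∑ k ∈ s, M k * |ξ' k - ξ k| := by
    intro ξ hξ ξ' hξ' s
    induction s using Finset.induction_on with
    | empty => simp
    | insert k s hk ih =>
      have hmem : s.piecewise ξ' ξ ∈ paramCube K := fun j => by
        by_cases hj : j ∈ s
        · rw [Finset.piecewise_eq_of_mem _ _ _ hj]; exact hξ' j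
        · rw [Finset.piecewise_eq_of_notMem _ _ _ hj]; exact hξ j
      have h1 := hS _ hmem k (ξ' k) (hξ' k)
      rw [Finset.piecewise_eq_of_notMem _ _ _ hk] at h1
      rw [Finset.piecewise_insert, Finset.sum_insert hk]
      exact (abs_sub_le _ _ _).trans (add_le_add h1 ih)
  intro ξ hξ
  have hlim : Tendsto (fun ξ' : Fin K → ℝ => ∑ k, M k * |ξ' k - ξ k|) (𝓝[paramCube K] ξ)
      (𝓝 0) := by
    have hcont : Continuous fun ξ' : Fin K → ℝ => ∑ k, M k * |ξ' k - ξ k| := by fun_prop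
    have := hcont.tendsto ξ
    simp only [sub_self, abs_zero, mul_zero, Finset.sum_const_zero] at this
    exact this.mono_left nhdsWithin_le_nhds
  rw [ContinuousWithinAt, tendsto_iff_norm_sub_tendsto_zero]
  refine squeeze_zero' (Eventually.of_forall fun _ => norm_nonneg _) ?_ hlim
  filter_upwards [self_mem_nhdsWithin] with ξ' hξ'
  have := key ξ hξ ξ' hξ' Finset.univ
  rwa [Finset.piecewise_univ] at this

end

/-! ### Sobolev gradients in `L²` and the stiffness entries -/

section

variable {d : ℕ} {D : Opens (Space d)}

lemma memLp_gradient (ψ : 𝓓(D, ℝ)) :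
    MemLp (gradient ψ) 2 (volume.restrict (D : Set (Space d))) := by
  have hc : Continuous (gradient ψ) :=
    (InnerProductSpace.toDual ℝ (Space d)).symm.continuous.comp
      (ψ.contDiff.continuous_fderiv (by simp))
  have hs : HasCompactSupport (gradient ψ) :=
    (ψ.hasCompactSupport.fderiv (𝕜 := ℝ)).comp_left (map_zero _)
  exact (hc.memLp_of_hasCompactSupport hs).restrict _

/-- The gradient of an `H¹` function as an element of `L²`. -/
noncomputable def SobolevH1.gradLp (u : SobolevH1 D) :
    Lp (Space d) 2 (volume.restrict (D : Set (Space d))) :=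
  u.grad_memLp.toLp u.grad

variable (D) in
/-- The closure in `L²` of the gradients of test functions. -/
noncomputable def gradientSpace :
    Submodule ℝ (Lp (Space d) 2 (volume.restrict (D : Set (Space d)))) :=
  (Submodule.span ℝ (range fun ψ : 𝓓(D, ℝ) => (memLp_gradient ψ).toLp)).topologicalClosure

lemma isClosed_gradientSpace :
    IsClosed (gradientSpace D : Set (Lp (Space d) 2 (volume.restrict (D : Set (Space d))))) :=
  Submodule.isClosed_topologicalClosure _

lemma EqOnBoundary.gradLp_sub_mem {u v : SobolevH1 D} (h : EqOnBoundary u v) :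
    u.gradLp - v.gradLp ∈ gradientSpace D := by
  change u.gradLp - v.gradLp ∈ closure _
  rw [EMetric.mem_closure_iff]
  intro ε hε
  obtain ⟨δ, hδ, hδε⟩ := exists_between hε
  obtain ⟨ψ, -, hψ⟩ := h δ hδ
  refine ⟨(memLp_gradient ψ).toLp, Submodule.subset_span ⟨ψ, rfl⟩, lt_of_le_of_lt ?_ hδε⟩
  rw [SobolevH1.gradLp, SobolevH1.gradLp, ← MemLp.toLp_sub, Lp.edist_toLp_toLp]
  exact hψ

lemma IsCellSolution.apply_eq_zero {a : Space d → ℝ} {p φ : SobolevH1 D}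
    (h : IsCellSolution a p φ)
    {B : Lp (Space d) 2 (volume.restrict (D : Set (Space d))) →L[ℝ]
      Lp (Space d) 2 (volume.restrict (D : Set (Space d))) →L[ℝ] ℝ}
    (hB : IsWeightedForm (volume.restrict (D : Set (Space d))) a B) :
    ∀ w ∈ gradientSpace D, B φ.gradLp w = 0 := by
  have hle : gradientSpace D ≤ LinearMap.ker (B φ.gradLp : _ →ₗ[ℝ] ℝ) := by
    refine Submodule.topologicalClosure_minimal _ (Submodule.span_le.mpr ?_)
      (B φ.gradLp).isClosed_ker
    rintro _ ⟨ψ, rfl⟩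
    change B φ.gradLp _ = 0
    rw [hB, ← h.2 ψ]
    refine integral_congr_ae ?_
    filter_upwards [φ.grad_memLp.coeFn_toLp, (memLp_gradient ψ).coeFn_toLp] with x h1 h2
    rw [SobolevH1.gradLp, h1, h2]
  exact fun w hw => hle hw

variable {K L : ℕ} {κ : Space d → (Fin K → ℝ) → ℝ} {κmin κmax : ℝ} {c : Fin K → ℝ}
  {p : Fin L → SobolevH1 D} {φ : Fin L → (Fin K → ℝ) → SobolevH1 D}

lemma stiffness_eq {B : Lp (Space d) 2 (volume.restrict (D : Set (Space d))) →L[ℝ]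
      Lp (Space d) 2 (volume.restrict (D : Set (Space d))) →L[ℝ] ℝ} {ξ : Fin K → ℝ}
    (hB : IsWeightedForm (volume.restrict (D : Set (Space d))) (fun x => κ x ξ) B)
    (l l' : Fin L) : stiffness κ φ l l' ξ = B (φ l ξ).gradLp (φ l' ξ).gradLp := by
  rw [hB, stiffness]
  refine integral_congr_ae ?_
  filter_upwards [(φ l ξ).grad_memLp.coeFn_toLp, (φ l' ξ).grad_memLp.coeFn_toLp] with x h1 h2
  rw [SobolevH1.gradLp, SobolevH1.gradLp, h1, h2]

theorem continuousOn_stiffness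
    (h : IsAnalyticCoefficient (volume.restrict (D : Set (Space d))) κ κmin κmax c)
    (hφ : ∀ l, ∀ ξ ∈ paramCube K, IsCellSolution (fun x => κ x ξ) (p l) (φ l ξ))
    (l l' : Fin L) : ContinuousOn (stiffness κ φ l l') (paramCube K) := by
  refine continuousOn_paramCube (M := fun k => c k * κmax *
    ((κmax / κmin * ‖(p l).gradLp‖) * (κmax / κmin * ‖(p l').gradLp‖))) fun ξ hξ k t ht => ?_
  have hξ' := update_mem_paramCube hξ k ht
  obtain ⟨B, hB⟩ := exists_isWeightedForm (F := Space d) (h.meas ξ hξ) (h.abs_le hξ)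
  obtain ⟨B', hB'⟩ := exists_isWeightedForm (F := Space d) (h.meas _ hξ') (h.abs_le hξ')
  rw [stiffness_eq hB, stiffness_eq hB']
  have hc := (h.rate_pos k).le
  have hmax := h.max_pos.le
  refine (hB.abs_energy_sub_le hB' (h.meas ξ hξ) (h.meas _ hξ') h.min_pos h.max_pos
    (h.bound ξ hξ) (h.bound _ hξ') (by positivity) (h.abs_update_sub_le hξ k ht)
    (hφ l ξ hξ).1.gradLp_sub_mem (hφ l' ξ hξ).1.gradLp_sub_mem
    (hφ l _ hξ').1.gradLp_sub_mem (hφ l' _ hξ').1.gradLp_sub_mem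
    ((hφ l _ hξ').apply_eq_zero hB') ((hφ l' ξ hξ).apply_eq_zero hB)).trans (le_of_eq ?_)
  ring

/-- The bound on the coefficients does not involve the base point `ξ`: the energies of the boundary
data there are at most `κmax` times their squared `L²` norms. This uniformity is what the gluing
needs. -/
lemma exists_stiffness_expansion
    (h : IsAnalyticCoefficient (volume.restrict (D : Set (Space d))) κ κmin κmax c)
    (hφ : ∀ l, ∀ ξ ∈ paramCube K, IsCellSolution (fun x => κ x ξ) (p l) (φ l ξ))
    (l l' : Fin L) (k : Fin K) {ξ : Fin K → ℝ} (hξ : ξ ∈ paramCube K) :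
    ∃ a : ℕ → ℝ, (∀ n, |a n| ≤ 2 * (√(κmax * ‖(p l).gradLp‖ ^ 2) *
        √(κmax * ‖(p l').gradLp‖ ^ 2)) * (2 * c k) ^ n) ∧
      ∀ t ∈ Icc (-1 : ℝ) 1, |t - ξ k| * (2 * c k) < 1 →
        HasSum (fun n => a n * (t - ξ k) ^ n) (stiffness κ φ l l' (Function.update ξ k t)) := by
  have hc := h.rate_pos k
  let f : Space d → ℝ → ℝ := fun x t => κ x (Function.update ξ k t)
  let b : ℕ → Space d → ℝ := fun n x =>
    iteratedDerivWithin n (f x) (Icc (-1) 1) (ξ k) / (n.factorial : ℝ)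
  have hfac : ∀ n : ℕ, (0 : ℝ) < n.factorial := fun n => by exact_mod_cast n.factorial_pos
  have hb0 : b 0 = fun x => κ x ξ := by
    ext x
    simp [b, f]
  have hbmeas : ∀ n, AEStronglyMeasurable (b n) (volume.restrict (D : Set (Space d))) := fun n => by
    simpa only [b, div_eq_mul_inv] using (aestronglyMeasurable_iteratedDerivWithin (f := f) (h.contDiffOn_line hξ k)
      (fun t ht => h.meas _ (update_mem_paramCube hξ k ht)) n _ (hξ k)).mul_const _
  have hbrel : ∀ n, ∀ᵐ x ∂(volume.restrict (D : Set (Space d))), |b n x| ≤ c k ^ n * b 0 x := by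
    intro n
    filter_upwards [h.growth_line hξ k] with x hx
    have h1 := hx n (ξ k) (hξ k)
    rw [hb0]
    simp only [b]
    rw [abs_div, abs_of_pos (hfac n), div_le_iff₀ (hfac n)]
    rw [Function.update_eq_self] at h1
    exact h1.trans (le_of_eq (by ring))
  have hbC : ∀ n, ∀ᵐ x ∂(volume.restrict (D : Set (Space d))), |b n x| ≤ κmax * c k ^ n := by
    intro n
    filter_upwards [hbrel n, h.bound ξ hξ] with x h1 h2
    rw [hb0] at h1
    refine h1.trans ?_
    rw [mul_comm κmax]
    gcongr
    exact h2.2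
  have hb0C : ∀ᵐ x ∂(volume.restrict (D : Set (Space d))), |b 0 x| ≤ κmax := by
    simpa using hbC 0
  choose B hB using fun n => exists_isWeightedForm (F := Space d) (hbmeas n) (hbC n)
  have hmin : ∀ᵐ x ∂(volume.restrict (D : Set (Space d))), κmin ≤ b 0 x := by
    rw [hb0]; exact (h.bound ξ hξ).mono fun x hx => hx.1
  have hmax : ∀ᵐ x ∂(volume.restrict (D : Set (Space d))), b 0 x ≤ κmax := by
    rw [hb0]; exact (h.bound ξ hξ).mono fun x hx => hx.2
  obtain ⟨a, ha, hexp⟩ := exists_energy_expansion isClosed_gradientSpace hc.le h.min_pos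
    ((hB 0).le_apply_self (hbmeas 0) hb0C hmin)
    (fun n u v => (hB 0).abs_apply_le (hB n) (hbmeas 0) (hbmeas n) (by positivity) (hbrel n)
      hb0C u v) (p l).gradLp (p l').gradLp
  refine ⟨a, fun n => (ha n).trans ?_, fun t ht hts => ?_⟩
  · have h1 := (hB 0).apply_self_le (hbmeas 0) hb0C hmax (p l).gradLp
    have h2 := (hB 0).apply_self_le (hbmeas 0) hb0C hmax (p l').gradLp
    gcongr
  · have hξ' := update_mem_paramCube hξ k ht
    obtain ⟨Bt, hBt⟩ := exists_isWeightedForm (F := Space d) (h.meas _ hξ') (h.abs_le hξ')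
    rw [stiffness_eq hBt]
    have hts' : |t - ξ k| * c k < 1 := by
      have := mul_nonneg (abs_nonneg (t - ξ k)) hc.le
      linarith
    refine hexp _ Bt _ _ hts (fun u v => hBt.hasSum hB hc.le hbmeas hbC hts' ?_ u v)
      (hBt.le_apply_self (h.meas _ hξ') (h.abs_le hξ')
        ((h.bound _ hξ').mono fun x hx => hx.1))
      (hφ l _ hξ').1.gradLp_sub_mem (hφ l' _ hξ').1.gradLp_sub_mem
      ((hφ l _ hξ').apply_eq_zero hBt)
    filter_upwards [h.contDiffOn_line hξ k, h.growth_line hξ k, h.mem_Icc_line hξ k]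
      with x h1 h2 h3
    refine hasSum_taylor h1 hc.le (M := κmax) (fun n s hs => (h2 n s hs).trans ?_) (hξ k) ht hts'
    have := (h3 s hs).2
    gcongr

theorem hasAnalyticExtension_stiffness
    (h : IsAnalyticCoefficient (volume.restrict (D : Set (Space d))) κ κmin κmax c)
    (hφ : ∀ l, ∀ ξ ∈ paramCube K, IsCellSolution (fun x => κ x ξ) (p l) (φ l ξ))
    (l l' : Fin L) (k : Fin K) {τ : ℝ} (hτ : τ < 1 / (2 * c k)) :
    HasAnalyticExtension (stiffness κ φ l l') k τ := by
  have hc := h.rate_pos k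
  have hmem : ∀ t ∈ Icc (-1 : ℝ) 1, ∀ η, insertParam k t η ∈ paramCube K := by
    intro t ht η j
    by_cases hj : j = k
    · simpa [insertParam, hj] using ht
    · simp only [insertParam, hj, dite_false]; exact (η ⟨j, hj⟩).2
  have hself : ∀ t η, insertParam k t η k = t := fun t η => by simp [insertParam]
  have hupd : ∀ s t η, Function.update (insertParam k s η) k t = insertParam k t η := by
    intro s t η
    ext j
    by_cases hj : j = k
    · subst hj; simp [insertParam]
    · simp [insertParam, hj]
  have hex := fun (t : ℝ) (ht : t ∈ Icc (-1 : ℝ) 1) (η : {j : Fin K // j ≠ k} → Icc (-1 : ℝ) 1) =>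
    exists_stiffness_expansion h hφ l l' k (hmem t ht η)
  choose! a ha hsum using hex
  simp only [hself, hupd] at hsum
  refine exists_analyticOnNhd_continuousMap (S := fun t η => stiffness κ φ l l' (insertParam k t η))
    (a := fun t n η => a t η n) (by positivity : 0 < 2 * c k) (by positivity)
    (fun t ht n η => ha t ht η n) (fun t₀ ht₀ t ht htt η => hsum t₀ ht₀ η t ht htt)
    (fun t ht => ?_) ((lt_div_iff₀ (by positivity)).mp hτ)
  refine (continuousOn_stiffness h hφ l l').comp_continuous ?_ (hmem t ht)
  refine continuous_pi fun j => ?_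
  by_cases hj : j = k
  · simp only [insertParam, hj, dite_true]; exact continuous_const
  · simp only [insertParam, hj, dite_false]
    exact continuous_subtype_val.comp (continuous_apply _)

end

end StoMsFEM

theorem theorem3p2 {d K L : ℕ}
    -- the patch
    (D : Opens (StoMsFEM.Space d))
    (hD : Bornology.IsBounded (D : Set (StoMsFEM.Space d)))
    -- the parametrized coefficient, uniformly elliptic and bounded
    (κ : StoMsFEM.Space d → (Fin K → ℝ) → ℝ)
    (κmin κmax : ℝ) (hκmin : 0 < κmin)
    (hκ_meas : ∀ ξ ∈ StoMsFEM.paramCube K,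
      AEStronglyMeasurable (fun x => κ x ξ) (volume.restrict (D : Set (StoMsFEM.Space d))))
    (hκ_bd : ∀ ξ ∈ StoMsFEM.paramCube K,
      ∀ᵐ x ∂(volume.restrict (D : Set (StoMsFEM.Space d))), κmin ≤ κ x ξ ∧ κ x ξ ≤ κmax)
    -- smoothness in the parameters and growth of the derivatives
    (hκ_smooth : ∀ᵐ x ∂(volume.restrict (D : Set (StoMsFEM.Space d))),
      ContDiffOn ℝ ∞ (κ x) (StoMsFEM.paramCube K))
    (c : Fin K → ℝ) (hc : ∀ k, 0 < c k)
    (hκ_growth : ∀ k, ∀ n : ℕ, ∀ ξ ∈ StoMsFEM.paramCube K,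
      ∀ᵐ x ∂(volume.restrict (D : Set (StoMsFEM.Space d))),
        |StoMsFEM.partialDeriv k n (κ x) ξ / κ x ξ| ≤ c k ^ n * (n.factorial : ℝ))
    -- the boundary data and the solutions of the cell problems
    (p : Fin L → StoMsFEM.SobolevH1 D)
    (φ : Fin L → (Fin K → ℝ) → StoMsFEM.SobolevH1 D)
    (hφ : ∀ l, ∀ ξ ∈ StoMsFEM.paramCube K,
      StoMsFEM.IsCellSolution (fun x => κ x ξ) (p l) (φ l ξ))
    (l l' : Fin L) :
    ContinuousOn (StoMsFEM.stiffness κ φ l l') (StoMsFEM.paramCube K) ∧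
    -- every `τ` in `(0, 1/(2 c_k))` is admissible in the direction `k`
    (∀ (k : Fin K) (τ : ℝ), 0 < τ → τ < 1 / (2 * c k) →
      StoMsFEM.HasAnalyticExtension (StoMsFEM.stiffness κ φ l l') k τ) ∧
    -- the error bound for every admissible choice of `τ`
    (∀ τ : Fin K → ℝ, (∀ k, 0 < τ k) →
      (∀ k, StoMsFEM.HasAnalyticExtension (StoMsFEM.stiffness κ φ l l') k (τ k)) →
      (∀ k, 0 < StoMsFEM.decayRate (τ k)) ∧
      ∃ Cs : ℝ, 0 < Cs ∧ ∀ ν : Fin K → ℕ, ∀ ξ ∈ StoMsFEM.paramCube K,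
        |StoMsFEM.stiffness κ φ l l' ξ -
            StoMsFEM.chebyshevInterpolant ν (StoMsFEM.stiffness κ φ l l') ξ| ≤
          Cs * (∏ k, (2 / Real.pi * Real.log ((ν k : ℝ) + 1) + 1)) *
            ∑ k, Real.exp (-(StoMsFEM.decayRate (τ k)) * (ν k : ℝ))) := by
  -- The upper bound becomes `max κmin κmax` because positivity of `κmax` cannot be deduced when the
  -- patch is empty.
  have hcoef : StoMsFEM.IsAnalyticCoefficient (volume.restrict (D : Set (StoMsFEM.Space d))) κ κmin
      (max κmin κmax) c :=
    { min_pos := hκmin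
      max_pos := lt_max_of_lt_left hκmin
      meas := hκ_meas
      bound := fun ξ hξ => (hκ_bd ξ hξ).mono fun _ hx => ⟨hx.1, hx.2.trans (le_max_right _ _)⟩
      smooth := hκ_smooth
      rate_pos := hc
      growth := hκ_growth }
  exact ⟨StoMsFEM.continuousOn_stiffness hcoef hφ l l',
    fun k _ _ hτ => StoMsFEM.hasAnalyticExtension_stiffness hcoef hφ l l' k hτ,
    fun _ hτ hext => ⟨fun k => StoMsFEM.decayRate_pos (hτ k),
      StoMsFEM.exists_abs_sub_chebyshevInterpolant_le hτ hext⟩⟩
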